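/- Let $W$ be a one-dimensional Brownian motion on a filtered probability space, and let $\widehat{\mathbb W}_t$ be the signature of $\widehat W_t=(t,W_t)$, i.e. the family $(\widehat{\mathbb W}_t^{v})_v$ indexed by the words $v$ over the alphabet $\{1,2\}$ with $\widehat{\mathbb W}_t^{\emptyset}=1$, $\widehat{\mathbb W}_t^{v1}=\int_0^t\widehat{\mathbb W}_s^{v}\,ds$ and $\widehat{\mathbb W}_t^{v2}=\int_0^t\widehat{\mathbb W}_s^{v}\circ dW_s$ (Stratonovich integral, in a version with a.s. continuous paths). For a family of real coefficients $\ell=(\ell^v)_v$ put $\langle \ell,\widehat{\mathbb W}_t\rangle=\sum_{n\ge 0}\sum_{|v|=n}\ell^v\,\widehat{\mathbb W}_t^{v}$ whenever $\sum_{n\ge 0}\bigl|\sum_{|v|=n}\ell^v\,\widehat{\mathbb W}_t^{v}\bigr|<\infty$. Let $T>0$ and let $K:(0,T]\to\mathbb R$ be square-integrable on $(0,T]$ and infinitely differentiable on $(0,T]$ (a singularity at $0$ is allowed), with $$\sum_{n=0}^\infty |K^{(n)}(t)|\frac{t^{n+1/2}}{n!\sqrt{2n+1}}<\infty,\qquad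 \int_0^t\Bigl(\sum_{n=0}^\infty |K^{(n)}(t)|\frac{s^n}{n!}\Bigr)^2ds<\infty\qquad\text{for all } t\in(0,T],$$ $$\int_0^T\sum_{n=0}^\infty |K^{(n)}(t)|\frac{t^{n+1/2}}{n!\sqrt{2n+1}}\,dt<\infty .$$ Define $\ell_t=\sum_{n=0}^\infty K^{(n)}(t)(-1)^n\,1^{\otimes n}2$ for $t\in(0,T]$ (the coefficient of the word consisting of $n$ letters $1$ followed by one letter $2$ is $(-1)^nK^{(n)}(t)$, all other coefficients vanish) and $\ell_0=0$. Then for every $t\in[0,T]$ the series $\langle \ell_t,\widehat{\mathbb W}_t\rangle$ converges absolutely in the above sense a.s., the Gaussian Volterra integral $X_t=\int_0^tK(t-s)\,dW_s$ exists as an $L^2$ Itô integral, and $$X_t=\langle \ell_t,\widehat{\mathbb W}_t\rangle\quad\text{a.s.}$$ Moreover, for every $H\in(0,1)$ and every $T>0$ the kernel $K(t)=t^{H-1/2}/\Gamma(H+\tfrac12)$ of the Riemann–Liouville fractional Brownian motion satisfies all of the above assumptions, so that the representation holds for it. -/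

import Mathlib

open MeasureTheory ProbabilityTheory Filter
open scoped NNReal ENNReal Topology

namespace SigVolterra

/-! ### The extended tensor algebra over `ℝ^d` -/

/-- Words over the alphabet with `d` letters. The letter numbered `i + 1` is `i : Fin d`, so that,
for `d = 2`, the first letter (time) is `0` and the second letter (noise) is `1`. -/
abbrev Word (d : ℕ) := List (Fin d)

/-- The extended tensor algebra: a sequence of tensors of all orders, given by its coordinates
in the basis of words. It carries the pointwise vector space structure and the topology of
coordinatewise convergence. -/
abbrev ExtTensor (d : ℕ) := Word d → ℝ

/-- The element of the extended tensor algebra that is the basis tensor of the word `v`. -/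
def ofWord {d : ℕ} (v : Word d) : ExtTensor d := Pi.single v 1

/-- The contribution of the words of length `n` to the bracket of `ℓ` and `p`. -/
def level {d : ℕ} (ℓ p : ExtTensor d) (n : ℕ) : ℝ :=
  ∑ v : Fin n → Fin d, ℓ (List.ofFn v) * p (List.ofFn v)

/-- The bracket of `ℓ` and `p` is well defined: its series over the levels converges absolutely. -/
def Admissible {d : ℕ} (ℓ p : ExtTensor d) : Prop :=
  Summable fun n => |level ℓ p n|

/-- The bracket of `ℓ` and `p`, the sum over all levels. -/
noncomputable def bracket {d : ℕ} (ℓ p : ExtTensor d) : ℝ :=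
  ∑' n, level ℓ p n

/-! ### Stochastic integrals -/

section Stochastic

variable {Ω : Type*} {mΩ : MeasurableSpace Ω}

/-- `W` is a (standard, one-dimensional) Brownian motion with respect to the filtration `F`. -/
structure IsFBrownianMotion (F : Filtration ℝ≥0 mΩ) (P : Measure Ω) (W : ℝ≥0 → Ω → ℝ) : Prop where
  isBrownian : IsBrownianReal W P
  adapted : StronglyAdapted F W
  indep : ∀ s t : ℝ≥0, s ≤ t →
    Indep (MeasurableSpace.comap (fun ω => W t ω - W s ω) inferInstance) (F s) P

/-- An elementary process: the value on the time interval `(τ k, τ (k + 1)]`, `k < m`, is a bounded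
random variable `ξ k` that is known at time `τ k`; the value at all other times is zero. -/
structure Elementary (F : Filtration ℝ≥0 mΩ) where
  m : ℕ
  τ : ℕ → ℝ≥0
  mono : Monotone τ
  ξ : ℕ → Ω → ℝ
  meas : ∀ k, StronglyMeasurable[F (τ k)] (ξ k)
  bdd : ∀ k, ∃ C : ℝ, ∀ ω, |ξ k ω| ≤ C

/-- The value of an elementary process at time `s`. -/
noncomputable def Elementary.eval {F : Filtration ℝ≥0 mΩ} (φ : Elementary F) (s : ℝ) (ω : Ω) : ℝ :=
  ∑ k ∈ Finset.range φ.m,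
    Set.indicator (Set.Ioc (φ.τ k : ℝ) (φ.τ (k + 1) : ℝ)) (fun _ => φ.ξ k ω) s

/-- The integral over `(0, t]` of an elementary process against `W`. -/
noncomputable def Elementary.integral {F : Filtration ℝ≥0 mΩ} (φ : Elementary F)
    (W : ℝ≥0 → Ω → ℝ) (t : ℝ≥0) (ω : Ω) : ℝ :=
  ∑ k ∈ Finset.range φ.m, φ.ξ k ω * (W (min (φ.τ (k + 1)) t) ω - W (min (φ.τ k) t) ω)

/-- `I` is (a version of) the Itô integral `∫_0^t H_s dW_s`: it is the limit in `L²(P)` of the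
integrals of elementary processes that converge to `H` in `L²((0, t] × Ω)`. -/
def IsItoIntegral (F : Filtration ℝ≥0 mΩ) (P : Measure Ω) (W : ℝ≥0 → Ω → ℝ)
    (H : ℝ → Ω → ℝ) (t : ℝ≥0) (I : Ω → ℝ) : Prop :=
  AEStronglyMeasurable (fun p : ℝ × Ω => H p.1 p.2)
      ((volume.restrict (Set.Ioc (0 : ℝ) t)).prod P) ∧
  AEStronglyMeasurable I P ∧
  ∃ φ : ℕ → Elementary F,
    Tendsto (fun n => eLpNorm (fun p : ℝ × Ω => (φ n).eval p.1 p.2 - H p.1 p.2) 2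
      ((volume.restrict (Set.Ioc (0 : ℝ) t)).prod P)) atTop (𝓝 0) ∧
    Tendsto (fun n => eLpNorm (fun ω => (φ n).integral W t ω - I ω) 2 P) atTop (𝓝 0)

/-- `C` is (a version of) the quadratic covariation `[Y, W]_t`: along every sequence of partitions
`0 = τ 0 ≤ ⋯ ≤ τ m = t` whose mesh tends to zero, the sums of products of increments converge
to `C` in probability. -/
def IsCovariation (P : Measure Ω) (Y W : ℝ≥0 → Ω → ℝ) (t : ℝ≥0) (C : Ω → ℝ) : Prop :=
  AEStronglyMeasurable C P ∧
  ∀ (m : ℕ → ℕ) (τ : ℕ → ℕ → ℝ≥0),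
    (∀ n, Monotone (τ n)) → (∀ n, τ n 0 = 0) → (∀ n, τ n (m n) = t) →
    (∀ δ : ℝ≥0, 0 < δ → ∀ᶠ n in atTop, ∀ k < m n, τ n (k + 1) - τ n k < δ) →
    TendstoInMeasure P
      (fun n ω => ∑ k ∈ Finset.range (m n),
        (Y (τ n (k + 1)) ω - Y (τ n k) ω) * (W (τ n (k + 1)) ω - W (τ n k) ω)) atTop C

/-- `Z` is (a version of) the Stratonovich integral `∫_0^t Y_s ∘ dW_s`, that is, the Itô integral
plus one half of the quadratic covariation of `Y` and `W`. -/
def IsStratonovichIntegral (F : Filtration ℝ≥0 mΩ) (P : Measure Ω) (W Y : ℝ≥0 → Ω → ℝ)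
    (t : ℝ≥0) (Z : Ω → ℝ) : Prop :=
  ∃ I C : Ω → ℝ, IsItoIntegral F P W (fun s ω => Y s.toNNReal ω) t I ∧ IsCovariation P Y W t C ∧
    ∀ᵐ ω ∂P, Z ω = I ω + 1 / 2 * C ω

open Classical in
/-- The Stratonovich integral process `∫_0^· Y_s ∘ dW_s`, in a version with almost surely
continuous paths (which is unique up to indistinguishability). -/
noncomputable def stratonovich (F : Filtration ℝ≥0 mΩ) (P : Measure Ω) (W Y : ℝ≥0 → Ω → ℝ) :
    ℝ≥0 → Ω → ℝ :=
  if h : ∃ Z : ℝ≥0 → Ω → ℝ, (∀ᵐ ω ∂P, Continuous fun t => Z t ω) ∧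
      ∀ t, IsStratonovichIntegral F P W Y t (Z t)
  then h.choose else 0

/-- The signature of `(t, W_t)` at a word, the last letter of the word coming first in the list. -/
noncomputable def signatureRev (F : Filtration ℝ≥0 mΩ) (P : Measure Ω) (W : ℝ≥0 → Ω → ℝ) :
    Word 2 → ℝ≥0 → Ω → ℝ
  | [] => fun _ _ => 1
  | i :: v =>
    if i = 0 then fun t ω => ∫ s in (0 : ℝ)..t, signatureRev F P W v s.toNNReal ω
    else stratonovich F P W (signatureRev F P W v)

/-- The signature of the time-extended Brownian motion `(t, W_t)`, at time `t`: the coordinate at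
the empty word is `1`, and the coordinate at a word that ends in the letter `i` is the Stratonovich
integral, against the `i`-th component of `(t, W_t)`, of the coordinate at the word without its last
letter. Against the first component, `t`, this is an ordinary integral. -/
noncomputable def signature (F : Filtration ℝ≥0 mΩ) (P : Measure Ω) (W : ℝ≥0 → Ω → ℝ)
    (t : ℝ≥0) (ω : Ω) : ExtTensor 2 :=
  fun v => signatureRev F P W v.reverse t ω

/-- `X` is (a version of) the process `X_t = ∫_0^t K(t - s) dW_s`, `0 ≤ t ≤ T`. -/
def IsVolterraProcess (F : Filtration ℝ≥0 mΩ) (P : Measure Ω) (W : ℝ≥0 → Ω → ℝ)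
    (T : ℝ) (K : ℝ → ℝ) (X : ℝ≥0 → Ω → ℝ) : Prop :=
  ∀ t : ℝ≥0, (t : ℝ) ≤ T → IsItoIntegral F P W (fun s _ => K (t - s)) t (X t)

end Stochastic

/-! ### Kernels and coefficients -/

/-- The `n`-th derivative of `K` on `(0, T]` (one-sided at `T`). -/
noncomputable def kernelDeriv (T : ℝ) (K : ℝ → ℝ) (n : ℕ) (t : ℝ) : ℝ :=
  iteratedDerivWithin n K (Set.Ioc 0 T) t

/-- The series `∑ |K⁽ⁿ⁾(t)| t^(n + 1/2) / (n! √(2n + 1))`, with values in `[0, ∞]`. -/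
noncomputable def weightedSeries (T : ℝ) (K : ℝ → ℝ) (t : ℝ) : ℝ≥0∞ :=
  ∑' n : ℕ, ENNReal.ofReal
    (|kernelDeriv T K n t| * t ^ ((n : ℝ) + 1 / 2) / ((n.factorial : ℝ) * √(2 * n + 1)))

/-- The series `∑ |K⁽ⁿ⁾(t)| sⁿ / n!`, with values in `[0, ∞]`. -/
noncomputable def taylorMajorant (T : ℝ) (K : ℝ → ℝ) (t s : ℝ) : ℝ≥0∞ :=
  ∑' n : ℕ, ENNReal.ofReal (|kernelDeriv T K n t| * s ^ n / (n.factorial : ℝ))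

/-- The assumptions on the kernel: `K` is square-integrable on `(0, T]`, infinitely differentiable
on `(0, T]`, and satisfies the three summability conditions. Only the values of `K` on `(0, T]`
matter. -/
structure VolterraKernel (T : ℝ) (K : ℝ → ℝ) : Prop where
  sq_integrable : MemLp K 2 (volume.restrict (Set.Ioc 0 T))
  smooth : ContDiffOn ℝ (⊤ : ℕ∞) K (Set.Ioc 0 T)
  series_lt_top : ∀ t ∈ Set.Ioc 0 T, weightedSeries T K t < ∞
  lintegral_majorant_lt_top : ∀ t ∈ Set.Ioc 0 T,
    ∫⁻ s in Set.Ioc 0 t, taylorMajorant T K t s ^ 2 < ∞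
  lintegral_series_lt_top : ∫⁻ t in Set.Ioc 0 T, weightedSeries T K t < ∞

open Classical in
/-- The coefficients `ℓ_t = ∑ₙ K⁽ⁿ⁾(t) (-1)ⁿ 1⋯12` (the first letter `n` times, then the second
letter) for `t ∈ (0, T]`, and `ℓ_t = 0` otherwise. -/
noncomputable def volterraCoeff (T : ℝ) (K : ℝ → ℝ) (t : ℝ) : ExtTensor 2 :=
  if t ∈ Set.Ioc 0 T then
    ∑' n : ℕ, (kernelDeriv T K n t * (-1) ^ n) • ofWord (List.replicate n (0 : Fin 2) ++ [1])
  else 0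

/-- The kernel `t^(H - 1/2) / Γ(H + 1/2)` of the Riemann–Liouville fractional Brownian motion. -/
noncomputable def rlKernel (H : ℝ) (t : ℝ) : ℝ :=
  t ^ (H - 1 / 2) / Real.Gamma (H + 1 / 2)

end SigVolterra

namespace SigVolterra

set_option linter.unusedSectionVars false

/-! ### The Itô isometry for elementary processes -/

section Isometry

variable {Ω : Type*} {mΩ : MeasurableSpace Ω} {P : Measure Ω} [IsProbabilityMeasure P]
  {F : Filtration ℝ≥0 mΩ} {W : ℝ≥0 → Ω → ℝ}

/-! Expand the kernel around `t`: for `0 < s < t`, `K(t - s) = ∑ K⁽ⁿ⁾(t) (-1)ⁿ sⁿ/n!`. Integrating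
term by term against `W` turns `sⁿ/n!` into `∫₀ᵗ sⁿ/n! dW_s`, which is the signature coordinate at
the word `1⋯12`: the letters `1` produce `sⁿ/n!`, and the Stratonovich correction vanishes because
this integrand is smooth and deterministic. So the series of integrals is the bracket with `ℓ_t`.

Two points need proof. The expansion must hold on all of `(0, t)`. The integral remainder is
compared with a single term of the weighted series; since `(u - x)/u ≤ (t - x)/t` for `x ≤ u ≤ t`,
it is at most a polynomial in `n` times `((t - x)/t)ⁿ` times the integral of the weighted series
(`enorm_taylor_remainder_le`). Sum and integral must also be exchanged. The weight `t^(n + 1/2)/(n!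
√(2n + 1))` is the `L²(0, t)` norm of `sⁿ/n!` (`eLpNorm_two_dividedPow`), so the `L²` norms of the
terms are summable, and the Itô isometry yields both a.s. absolute convergence and the
identification of the sum (`isItoIntegral_tsum`).

Integrals of smooth deterministic functions are handled pathwise through integration by parts
(`isItoIntegral_integralByParts`), which also supplies the continuous version behind `stratonovich`.

For the Riemann–Liouville kernel, put `α = H - 1/2`. The powers of `t` in the weighted series
combine to `t^H`, and the generalized binomial coefficients of `α` are `O(n^(-α-1))`; with the extra
`n^(-1/2)` from the weight this gives the summable `n^(-1-H)`. -/

theorem IsFBrownianMotion.stronglyMeasurable (hW : IsFBrownianMotion F P W) (t : ℝ≥0) :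
    StronglyMeasurable (W t) := (hW.adapted t).mono (F.le t)

theorem IsFBrownianMotion.stronglyMeasurable_of_le (hW : IsFBrownianMotion F P W) {s t : ℝ≥0}
    (h : s ≤ t) : StronglyMeasurable[F t] (W s) := (hW.adapted s).mono (F.mono h)

theorem IsFBrownianMotion.memLp_eval (hW : IsFBrownianMotion F P W) (t : ℝ≥0) :
    MemLp (W t) 2 P :=
  (hW.isBrownian.isGaussianProcess.hasGaussianLaw_eval t).memLp_two

theorem IsFBrownianMotion.memLp_sub (hW : IsFBrownianMotion F P W) (s t : ℝ≥0) :
    MemLp (fun ω => W t ω - W s ω) 2 P := (hW.memLp_eval t).sub (hW.memLp_eval s)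

theorem IsFBrownianMotion.integral_sub (hW : IsFBrownianMotion F P W) (s t : ℝ≥0) :
    ∫ ω, (W t ω - W s ω) ∂P = 0 := by
  rw [MeasureTheory.integral_sub ((hW.memLp_eval t).integrable one_le_two)
    ((hW.memLp_eval s).integrable one_le_two), hW.isBrownian.integral_eval,
    hW.isBrownian.integral_eval, sub_zero]

theorem IsFBrownianMotion.integral_sub_sq (hW : IsFBrownianMotion F P W) {s t : ℝ≥0}
    (h : s ≤ t) : ∫ ω, (W t ω - W s ω) ^ 2 ∂P = ((t - s : ℝ≥0) : ℝ) := by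
  have h1 := (hW.isBrownian.hasLaw_sub t s).variance_eq
  rw [variance_id_gaussianReal] at h1
  have h2 := variance_eq_sub (hW.memLp_sub s t)
  have h0 := hW.integral_sub s t
  have h3 : Var[W t - W s; P] = Var[fun ω => W t ω - W s ω; P] := rfl
  rw [h3, h2] at h1
  simp only [h0, Pi.pow_apply] at h1
  rw [NNReal.coe_sub h]
  have h5 : ((nndist t.1 s.1 : ℝ≥0) : ℝ) = t - s := by
    rw [coe_nndist, Real.dist_eq]
    exact abs_of_nonneg (sub_nonneg.2 (NNReal.coe_le_coe.2 h))
  rw [h5] at h1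
  simpa using h1

theorem IsFBrownianMotion.indepFun_sub (hW : IsFBrownianMotion F P W) {s t : ℝ≥0} (h : s ≤ t)
    {Y : Ω → ℝ} (hY : StronglyMeasurable[F s] Y) :
    IndepFun Y (fun ω => W t ω - W s ω) P := by
  rw [IndepFun_iff_Indep]
  exact (indep_of_indep_of_le_right (hW.indep s t h) hY.measurable.comap_le).symm

theorem IsFBrownianMotion.integral_mul_sub (hW : IsFBrownianMotion F P W) {s t : ℝ≥0} (h : s ≤ t)
    {Y : Ω → ℝ} (hY : StronglyMeasurable[F s] Y) :
    ∫ ω, Y ω * (W t ω - W s ω) ∂P = 0 := by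
  rw [(hW.indepFun_sub h hY).integral_fun_mul_eq_mul_integral
    (hY.mono (F.le s)).aestronglyMeasurable (hW.memLp_sub s t).1, hW.integral_sub, mul_zero]

theorem IsFBrownianMotion.integral_mul_sub_sq (hW : IsFBrownianMotion F P W) {s t : ℝ≥0}
    (h : s ≤ t) {Y : Ω → ℝ} (hY : StronglyMeasurable[F s] Y) :
    ∫ ω, Y ω * (W t ω - W s ω) ^ 2 ∂P = (∫ ω, Y ω ∂P) * ((t - s : ℝ≥0) : ℝ) := by
  have := (hW.indepFun_sub h hY).comp measurable_id (measurable_id.pow_const 2)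
  have h2 := this.integral_fun_mul_eq_mul_integral
    (hY.mono (F.le s)).aestronglyMeasurable ((hW.memLp_sub s t).1.pow 2)
  simp only [Function.comp_def, id_eq] at h2
  rw [h2, hW.integral_sub_sq h]

theorem memLp_two_bdd_mul {ξ f : Ω → ℝ} (hξ : StronglyMeasurable ξ) (hb : ∃ C : ℝ, ∀ ω, |ξ ω| ≤ C)
    (hf : MemLp f 2 P) : MemLp (fun ω => ξ ω * f ω) 2 P := by
  obtain ⟨C, hC⟩ := hb
  exact hf.of_le_mul (c := C) (hξ.aestronglyMeasurable.mul hf.1)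
    (Eventually.of_forall fun ω => by
      rw [norm_mul]; exact mul_le_mul_of_nonneg_right (hC ω) (norm_nonneg _))

/-- The covariance of two weighted increments, the first one starting first. -/
theorem IsFBrownianMotion.integral_increments_of_le (hW : IsFBrownianMotion F P W)
    {a b c d : ℝ≥0} (hab : a ≤ b) (hcd : c ≤ d) (hac : a ≤ c) {ξ η : Ω → ℝ}
    (hξ : StronglyMeasurable[F a] ξ) (hη : StronglyMeasurable[F c] η)
    (bξ : ∃ C : ℝ, ∀ ω, |ξ ω| ≤ C) (bη : ∃ C : ℝ, ∀ ω, |η ω| ≤ C) :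
    ∫ ω, (ξ ω * (W b ω - W a ω)) * (η ω * (W d ω - W c ω)) ∂P
      = (∫ ω, ξ ω * η ω ∂P) * ((min b d - max a c : ℝ≥0) : ℝ) := by
  have mξ := hξ.mono (F.mono hac)
  have hint : ∀ u v x y : ℝ≥0, Integrable
      (fun ω => (ξ ω * (W v ω - W u ω)) * (η ω * (W y ω - W x ω))) P := fun u v x y =>
    (memLp_two_bdd_mul (hξ.mono (F.le _)) bξ (hW.memLp_sub u v)).integrable_mul
      (memLp_two_bdd_mul (hη.mono (F.le _)) bη (hW.memLp_sub x y))
  -- increments over disjoint intervals are uncorrelated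
  have disj : ∀ u v : ℝ≥0, u ≤ c → v ≤ c →
      ∫ ω, (ξ ω * (W v ω - W u ω)) * (η ω * (W d ω - W c ω)) ∂P = 0 := by
    intro u v hu hv
    have := hW.integral_mul_sub hcd (Y := fun ω => ξ ω * (W v ω - W u ω) * η ω)
      ((mξ.mul ((hW.stronglyMeasurable_of_le hv).sub (hW.stronglyMeasurable_of_le hu))).mul hη)
    rw [← this]; congr 1; ext ω; ring
  rw [max_eq_right hac]
  rcases le_total b c with hbc | hcb
  · rw [disj a b hac hbc, tsub_eq_zero_of_le ((min_le_left _ _).trans hbc)]; simp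
  -- Cut the first increment at `c`: the piece over `(a, c]` is over before the second increment
  -- starts and contributes nothing.
  have e1 : ∫ ω, (ξ ω * (W b ω - W a ω)) * (η ω * (W d ω - W c ω)) ∂P
      = ∫ ω, (ξ ω * (W b ω - W c ω)) * (η ω * (W d ω - W c ω)) ∂P := by
    rw [← sub_eq_zero, ← MeasureTheory.integral_sub (hint _ _ _ _) (hint _ _ _ _),
      ← disj a c hac le_rfl]
    congr 1; ext ω; ring
  rw [e1]
  have sq : ∀ e : ℝ≥0, c ≤ e → ∫ ω, (ξ ω * (W e ω - W c ω)) * (η ω * (W e ω - W c ω)) ∂P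
      = (∫ ω, ξ ω * η ω ∂P) * ((e - c : ℝ≥0) : ℝ) := by
    intro e he
    have := hW.integral_mul_sub_sq he (Y := fun ω => ξ ω * η ω) (mξ.mul hη)
    rw [← this]
    congr 1; ext ω; ring
  -- Both increments now start at `c`. The longer one is cut at the end of the shorter, its excess
  -- being centred and independent of the rest.
  rcases le_total b d with hbd | hdb
  · rw [min_eq_left hbd, ← sq b hcb, ← sub_eq_zero,
      ← MeasureTheory.integral_sub (hint _ _ _ _) (hint _ _ _ _)]
    have := hW.integral_mul_sub hbd (Y := fun ω => ξ ω * (W b ω - W c ω) * η ω)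
      (((hξ.mono (F.mono hab)).mul ((hW.stronglyMeasurable_of_le le_rfl).sub
        (hW.stronglyMeasurable_of_le hcb))).mul (hη.mono (F.mono hcb)))
    rw [← this]; congr 1; ext ω; ring
  · rw [min_eq_right hdb, ← sq d hcd, ← sub_eq_zero,
      ← MeasureTheory.integral_sub (hint _ _ _ _) (hint _ _ _ _)]
    have := hW.integral_mul_sub hdb (Y := fun ω => ξ ω * η ω * (W d ω - W c ω))
      (((mξ.mono (F.mono hcd)).mul (hη.mono (F.mono hcd))).mul
        ((hW.stronglyMeasurable_of_le le_rfl).sub (hW.stronglyMeasurable_of_le hcd)))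
    rw [← this]; congr 1; ext ω; ring

theorem IsFBrownianMotion.integral_increments (hW : IsFBrownianMotion F P W)
    {a b c d : ℝ≥0} (hab : a ≤ b) (hcd : c ≤ d) {ξ η : Ω → ℝ}
    (hξ : StronglyMeasurable[F a] ξ) (hη : StronglyMeasurable[F c] η)
    (bξ : ∃ C : ℝ, ∀ ω, |ξ ω| ≤ C) (bη : ∃ C : ℝ, ∀ ω, |η ω| ≤ C) :
    ∫ ω, (ξ ω * (W b ω - W a ω)) * (η ω * (W d ω - W c ω)) ∂P
      = (∫ ω, ξ ω * η ω ∂P) * ((min b d - max a c : ℝ≥0) : ℝ) := by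
  rcases le_total a c with h | h
  · exact hW.integral_increments_of_le hab hcd h hξ hη bξ bη
  · have := hW.integral_increments_of_le hcd hab h hη hξ bη bξ
    simp only [mul_comm (η _), min_comm d, max_comm c] at this
    rw [← this]; congr 1; ext ω; ring

/-- All endpoints are capped at `t` on the right-hand side to match the covariance of increments
stopped at `t`. Truncated subtraction in `ℝ≥0` covers intervals that do not overlap. -/
theorem integral_indicator_Ioc_mul (t a b c d : ℝ≥0) :
    ∫ s in Set.Ioc (0 : ℝ) t, (Set.Ioc (a : ℝ) b).indicator (fun _ => (1 : ℝ)) s *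
      (Set.Ioc (c : ℝ) d).indicator (fun _ => (1 : ℝ)) s
      = ((min (min b t) (min d t) - max (min a t) (min c t) : ℝ≥0) : ℝ) := by
  have h1 : ∀ s : ℝ, (Set.Ioc (a : ℝ) b).indicator (fun _ => (1 : ℝ)) s *
      (Set.Ioc (c : ℝ) d).indicator (fun _ => (1 : ℝ)) s
      = (Set.Ioc (max a c : ℝ) (min b d)).indicator (fun _ => (1 : ℝ)) s := by
    intro s
    rw [← Set.Ioc_inter_Ioc]
    simp only [Set.indicator_apply, Set.mem_inter_iff]
    split_ifs <;> simp_all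
  simp_rw [h1]
  rw [integral_indicator measurableSet_Ioc, setIntegral_const, Measure.real,
    Measure.restrict_apply measurableSet_Ioc, Set.Ioc_inter_Ioc, Real.volume_Ioc]
  rw [smul_eq_mul, mul_one, ENNReal.toReal_ofReal', NNReal.coe_sub_def]
  push_cast
  have e1 : min (min (b : ℝ) t) (min (d : ℝ) t) = min (min (b : ℝ) d) t :=
    (inf_inf_distrib_right (b : ℝ) d t).symm
  have e2 : max (min (a : ℝ) t) (min (c : ℝ) t) = min (max (a : ℝ) c) t :=
    (inf_sup_right (a : ℝ) c t).symm
  have e3 : max (max (a : ℝ) c) 0 = max (a : ℝ) c := max_eq_left (le_max_of_le_left a.coe_nonneg)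
  rw [e1, e2, e3]
  have hx : min (min (b : ℝ) d) t ≤ t := min_le_right _ _
  rcases le_total (max (a : ℝ) c) t with h | h
  · rw [min_eq_left h]
  · rw [min_eq_right h, max_eq_right (by linarith), max_eq_right (by linarith)]

theorem Elementary.eval_eq (φ : Elementary F) (s : ℝ) (ω : Ω) :
    φ.eval s ω = ∑ k ∈ Finset.range φ.m,
      (Set.Ioc (φ.τ k : ℝ) (φ.τ (k + 1) : ℝ)).indicator (fun _ => (1 : ℝ)) s * φ.ξ k ω := by
  refine Finset.sum_congr rfl fun k _ => ?_
  simp only [Set.indicator_apply]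
  split_ifs <;> simp

theorem Elementary.stronglyMeasurable_ξ (φ : Elementary F) (k : ℕ) : StronglyMeasurable (φ.ξ k) :=
  (φ.meas k).mono (F.le _)

theorem Elementary.memLp_integral (φ : Elementary F) (hW : IsFBrownianMotion F P W) (t : ℝ≥0) :
    MemLp (φ.integral W t) 2 P :=
  memLp_finsetSum _ fun k _ =>
    memLp_two_bdd_mul (φ.stronglyMeasurable_ξ k) (φ.bdd k) (hW.memLp_sub _ _)

theorem Elementary.memLp_eval (φ : Elementary F) (t : ℝ≥0) :
    MemLp (fun p : ℝ × Ω => φ.eval p.1 p.2) 2 ((volume.restrict (Set.Ioc (0 : ℝ) t)).prod P) := by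
  simp_rw [φ.eval_eq]
  refine memLp_finsetSum _ fun k _ => ?_
  obtain ⟨C, hC⟩ := φ.bdd k
  refine MemLp.of_bound (C := C) ?_ (Eventually.of_forall fun p => ?_)
  · exact (((measurable_const.indicator measurableSet_Ioc).stronglyMeasurable.comp_measurable
      measurable_fst).mul ((φ.stronglyMeasurable_ξ k).comp_measurable
        measurable_snd)).aestronglyMeasurable
  · rw [norm_mul]
    calc _ ≤ 1 * C := mul_le_mul ?_ (hC _) (abs_nonneg _) zero_le_one
      _ = C := one_mul C
    simp only [Set.indicator_apply]
    split_ifs <;> simp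

/-- The polarized Itô isometry: in the double sum each pair of increments contributes the length of
their overlap. The bilinear form avoids a common refinement of the two time grids. -/
theorem Elementary.integral_mul_integral (hW : IsFBrownianMotion F P W) (φ ψ : Elementary F)
    (t : ℝ≥0) : ∫ ω, φ.integral W t ω * ψ.integral W t ω ∂P
      = ∫ p : ℝ × Ω, φ.eval p.1 p.2 * ψ.eval p.1 p.2
          ∂((volume.restrict (Set.Ioc (0 : ℝ) t)).prod P) := by
  simp_rw [Elementary.eval_eq, Elementary.integral, Finset.sum_mul_sum]
  have hb : ∀ (k j : ℕ), ∃ C : ℝ, ∀ ω, |φ.ξ k ω * ψ.ξ j ω| ≤ C := by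
    intro k j
    obtain ⟨C, hC⟩ := φ.bdd k
    obtain ⟨D, hD⟩ := ψ.bdd j
    refine ⟨C * D, fun ω => ?_⟩
    rw [abs_mul]
    exact mul_le_mul (hC ω) (hD ω) (abs_nonneg _) ((abs_nonneg _).trans (hC ω))
  have hi : ∀ k j : ℕ, Integrable (fun p : ℝ × Ω =>
      ((Set.Ioc (φ.τ k : ℝ) (φ.τ (k + 1) : ℝ)).indicator (fun _ => (1 : ℝ)) p.1 *
        (Set.Ioc (ψ.τ j : ℝ) (ψ.τ (j + 1) : ℝ)).indicator (fun _ => (1 : ℝ)) p.1) *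
      (φ.ξ k p.2 * ψ.ξ j p.2)) ((volume.restrict (Set.Ioc (0 : ℝ) t)).prod P) := by
    intro k j
    obtain ⟨C, hC⟩ := hb k j
    refine Integrable.mul_prod (f := fun s => (Set.Ioc (φ.τ k : ℝ) (φ.τ (k + 1) : ℝ)).indicator
      (fun _ => (1 : ℝ)) s * (Set.Ioc (ψ.τ j : ℝ) (ψ.τ (j + 1) : ℝ)).indicator
      (fun _ => (1 : ℝ)) s) (g := fun ω => φ.ξ k ω * ψ.ξ j ω) ?_ ?_
    · refine Integrable.of_bound (C := 1) ?_ (Eventually.of_forall fun s => ?_)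
      · exact ((measurable_const.indicator measurableSet_Ioc).mul
          (measurable_const.indicator measurableSet_Ioc)).aestronglyMeasurable
      · simp only [Set.indicator_apply]
        split_ifs <;> simp
    · exact Integrable.of_bound (C := C) ((φ.stronglyMeasurable_ξ k).mul
        (ψ.stronglyMeasurable_ξ j)).aestronglyMeasurable (Eventually.of_forall hC)
  have e : ∀ k j : ℕ, ∀ p : ℝ × Ω,
      ((Set.Ioc (φ.τ k : ℝ) (φ.τ (k + 1) : ℝ)).indicator (fun _ => (1 : ℝ)) p.1 * φ.ξ k p.2) *
        ((Set.Ioc (ψ.τ j : ℝ) (ψ.τ (j + 1) : ℝ)).indicator (fun _ => (1 : ℝ)) p.1 * ψ.ξ j p.2)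
      = ((Set.Ioc (φ.τ k : ℝ) (φ.τ (k + 1) : ℝ)).indicator (fun _ => (1 : ℝ)) p.1 *
        (Set.Ioc (ψ.τ j : ℝ) (ψ.τ (j + 1) : ℝ)).indicator (fun _ => (1 : ℝ)) p.1) *
      (φ.ξ k p.2 * ψ.ξ j p.2) := fun k j p => by ring
  have hL : ∀ k j : ℕ, Integrable (fun ω =>
      φ.ξ k ω * (W (min (φ.τ (k + 1)) t) ω - W (min (φ.τ k) t) ω) *
      (ψ.ξ j ω * (W (min (ψ.τ (j + 1)) t) ω - W (min (ψ.τ j) t) ω))) P := fun k j =>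
    (memLp_two_bdd_mul (φ.stronglyMeasurable_ξ k) (φ.bdd k) (hW.memLp_sub _ _)).integrable_mul
      (memLp_two_bdd_mul (ψ.stronglyMeasurable_ξ j) (ψ.bdd j) (hW.memLp_sub _ _))
  simp_rw [e]
  rw [integral_finsetSum _ fun k _ => integrable_finsetSum _ fun j _ => hL k j,
    integral_finsetSum _ fun k _ => integrable_finsetSum _ fun j _ => hi k j]
  refine Finset.sum_congr rfl fun k _ => ?_
  rw [integral_finsetSum _ fun j _ => hL k j, integral_finsetSum _ fun j _ => hi k j]
  refine Finset.sum_congr rfl fun j _ => ?_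
  rw [integral_prod_mul (fun s => (Set.Ioc (φ.τ k : ℝ) (φ.τ (k + 1) : ℝ)).indicator
      (fun _ => (1 : ℝ)) s * (Set.Ioc (ψ.τ j : ℝ) (ψ.τ (j + 1) : ℝ)).indicator
      (fun _ => (1 : ℝ)) s) (fun ω => φ.ξ k ω * ψ.ξ j ω), integral_indicator_Ioc_mul]
  have hk := φ.mono (Nat.le_succ k)
  have hj := ψ.mono (Nat.le_succ j)
  -- If `t < τ k`, then `ξ k` need not be known at the capped time `t`, so the covariance formula
  -- does not apply; but the stopped increment and the overlap both vanish.
  rcases lt_or_ge t (φ.τ k) with h1 | h1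
  · rw [min_eq_right h1.le, min_eq_right (h1.le.trans hk), tsub_eq_zero_of_le (by
      exact (min_le_left _ _).trans (le_max_left _ _))]
    simp
  rcases lt_or_ge t (ψ.τ j) with h2 | h2
  · rw [min_eq_right h2.le, min_eq_right (h2.le.trans hj), tsub_eq_zero_of_le (by
      exact (min_le_right _ _).trans (le_max_right _ _))]
    simp
  rw [min_eq_left h1, min_eq_left h2, mul_comm]
  rw [hW.integral_increments (le_min hk h1) (le_min hj h2) (φ.meas k) (ψ.meas j)
    (φ.bdd k) (ψ.bdd j), mul_comm]

theorem eLpNorm_two_eq_ofReal_sqrt {α : Type*} {mα : MeasurableSpace α} {μ : Measure α}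
    {f : α → ℝ} (hf : MemLp f 2 μ) : eLpNorm f 2 μ = ENNReal.ofReal (√(∫ x, f x ^ 2 ∂μ)) := by
  rw [hf.eLpNorm_eq_integral_rpow_norm two_ne_zero ENNReal.ofNat_ne_top, Real.sqrt_eq_rpow]
  simp

theorem Elementary.eLpNorm_integral_sub (hW : IsFBrownianMotion F P W) (φ ψ : Elementary F)
    (t : ℝ≥0) : eLpNorm (fun ω => φ.integral W t ω - ψ.integral W t ω) 2 P
      = eLpNorm (fun p : ℝ × Ω => φ.eval p.1 p.2 - ψ.eval p.1 p.2) 2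
          ((volume.restrict (Set.Ioc (0 : ℝ) t)).prod P) := by
  have a1 := φ.memLp_integral hW t
  have a2 := ψ.memLp_integral hW t
  have b1 := φ.memLp_eval (P := P) t
  have b2 := ψ.memLp_eval (P := P) t
  refine (eLpNorm_two_eq_ofReal_sqrt (a1.sub a2)).trans
    (Eq.trans ?_ (eLpNorm_two_eq_ofReal_sqrt (b1.sub b2)).symm)
  congr 2
  simp only [Pi.sub_apply]
  have ex : ∀ x y : ℝ, (x - y) ^ 2 = x * x - (x * y) - (x * y) + y * y := fun x y => by ring
  simp_rw [ex]
  rw [integral_add, MeasureTheory.integral_sub, MeasureTheory.integral_sub, integral_add,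
    MeasureTheory.integral_sub, MeasureTheory.integral_sub]
  · simp_rw [Elementary.integral_mul_integral hW]
  · exact b1.integrable_mul b1
  · exact b1.integrable_mul b2
  · exact (b1.integrable_mul b1).sub (b1.integrable_mul b2)
  · exact b1.integrable_mul b2
  · exact ((b1.integrable_mul b1).sub (b1.integrable_mul b2)).sub (b1.integrable_mul b2)
  · exact b2.integrable_mul b2
  · exact a1.integrable_mul a1
  · exact a1.integrable_mul a2
  · exact (a1.integrable_mul a1).sub (a1.integrable_mul a2)
  · exact a1.integrable_mul a2
  · exact ((a1.integrable_mul a1).sub (a1.integrable_mul a2)).sub (a1.integrable_mul a2)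
  · exact a2.integrable_mul a2

end Isometry

/-! ### Convergence in `L²` -/

section LTwo

variable {α : Type*} {mα : MeasurableSpace α} {μ : Measure α}

/-- Fatou's lemma for `L²` norms. -/
theorem eLpNorm_two_le_of_tendsto_ae {f : ℕ → α → ℝ} (hf : ∀ m, AEStronglyMeasurable (f m) μ)
    {g : α → ℝ} (h : ∀ᵐ x ∂μ, Tendsto (fun m => f m x) atTop (𝓝 (g x))) {u : ℕ → ℝ≥0∞} {a : ℝ≥0∞}
    (hu : Tendsto u atTop (𝓝 a)) (hle : ∀ m, eLpNorm (f m) 2 μ ≤ u m) : eLpNorm g 2 μ ≤ a :=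
  (Lp.eLpNorm_lim_le_liminf_eLpNorm hf g h).trans
    ((liminf_le_liminf (Eventually.of_forall hle)).trans hu.liminf_eq.le)

theorem eLpNorm_two_sub_le {f g h : α → ℝ} (hf : AEStronglyMeasurable f μ)
    (hg : AEStronglyMeasurable g μ) (hh : AEStronglyMeasurable h μ) :
    eLpNorm (fun x => f x - h x) 2 μ
      ≤ eLpNorm (fun x => f x - g x) 2 μ + eLpNorm (fun x => g x - h x) 2 μ := by
  have : (fun x => f x - h x) = (fun x => f x - g x) + fun x => g x - h x := by
    ext x; simp
  rw [this]
  exact eLpNorm_add_le (hf.sub hg) (hg.sub hh) one_le_two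

theorem eLpNorm_two_sub_comm (f g : α → ℝ) :
    eLpNorm (fun x => f x - g x) 2 μ = eLpNorm (fun x => g x - f x) 2 μ :=
  eLpNorm_sub_comm f g 2 μ

/-- If the `L²` norms of the terms of a series are summable then the series converges in `L²` to
its almost everywhere limit. -/
theorem tendsto_eLpNorm_two_sum_sub {f : ℕ → α → ℝ} (hf : ∀ n, AEStronglyMeasurable (f n) μ)
    (hs : ∑' n, eLpNorm (f n) 2 μ ≠ ∞) {g : α → ℝ}
    (h : ∀ᵐ x ∂μ, Tendsto (fun N => ∑ n ∈ Finset.range N, f n x) atTop (𝓝 (g x))) :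
    Tendsto (fun N => eLpNorm (fun x => ∑ n ∈ Finset.range N, f n x - g x) 2 μ) atTop (𝓝 0) := by
  refine tendsto_of_tendsto_of_tendsto_of_le_of_le tendsto_const_nhds
    (ENNReal.tendsto_sum_nat_add _ hs) (fun _ => zero_le) fun N => ?_
  have hm : ∀ s : Finset ℕ, ∀ k, AEStronglyMeasurable (fun x => ∑ n ∈ s, f (k + n) x) μ :=
    fun s k => Finset.aestronglyMeasurable_fun_sum s fun n _ => hf (k + n)
  rw [eLpNorm_two_sub_comm]
  -- The error after `N` terms is the a.e. limit of finite tails, each bounded by the tail of the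
  -- series of norms.
  refine eLpNorm_two_le_of_tendsto_ae (f := fun m x => ∑ n ∈ Finset.range m, f (N + n) x)
    (fun m => hm _ N) ?_ tendsto_const_nhds fun m => ?_
  · filter_upwards [h] with x hx
    have h2 := (hx.comp (tendsto_add_atTop_nat N)).sub_const (∑ n ∈ Finset.range N, f n x)
    refine h2.congr fun m => ?_
    simp only [Function.comp]
    rw [add_comm m N, Finset.sum_range_add, add_sub_cancel_left]
  · have : (fun x => ∑ n ∈ Finset.range m, f (N + n) x) = ∑ n ∈ Finset.range m, f (N + n) := by
      ext x; simp
    rw [this]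
    refine (eLpNorm_sum_le (fun n _ => hf (N + n)) one_le_two).trans ?_
    simp_rw [add_comm N]
    exact ENNReal.sum_le_tsum _

end LTwo

/-! ### Itô integrals -/

section Ito

variable {Ω : Type*} {mΩ : MeasurableSpace Ω} {P : Measure Ω} [IsProbabilityMeasure P]
  {F : Filtration ℝ≥0 mΩ} {W : ℝ≥0 → Ω → ℝ}

/-- The elementary process that vanishes. -/
def Elementary.zero (F : Filtration ℝ≥0 mΩ) : Elementary F where
  m := 0
  τ := fun _ => 0
  mono := monotone_const
  ξ := fun _ _ => 0
  meas := fun _ => stronglyMeasurable_const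
  bdd := fun _ => ⟨0, fun _ => by simp⟩

theorem Elementary.eLpNorm_integral (hW : IsFBrownianMotion F P W) (φ : Elementary F) (t : ℝ≥0) :
    eLpNorm (φ.integral W t) 2 P
      = eLpNorm (fun p : ℝ × Ω => φ.eval p.1 p.2) 2
          ((volume.restrict (Set.Ioc (0 : ℝ) t)).prod P) := by
  have e1 : ∀ s ω, (Elementary.zero F).eval s ω = 0 := fun _ _ => Finset.sum_range_zero _
  have e2 : ∀ ω, (Elementary.zero F).integral W t ω = 0 := fun _ => Finset.sum_range_zero _
  simpa only [e1, e2, sub_zero] using φ.eLpNorm_integral_sub hW (Elementary.zero F) t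

/-- Elementary processes that converge to `H` in `L²` and whose integrals converge almost surely
have the Itô integral of `H` as the limit of their integrals. -/
theorem isItoIntegral_of_tendsto_ae (hW : IsFBrownianMotion F P W) {H : ℝ → Ω → ℝ} {t : ℝ≥0}
    {I : Ω → ℝ} (φ : ℕ → Elementary F)
    (hH : AEStronglyMeasurable (fun p : ℝ × Ω => H p.1 p.2)
      ((volume.restrict (Set.Ioc (0 : ℝ) t)).prod P))
    (h1 : Tendsto (fun n => eLpNorm (fun p : ℝ × Ω => (φ n).eval p.1 p.2 - H p.1 p.2) 2
      ((volume.restrict (Set.Ioc (0 : ℝ) t)).prod P)) atTop (𝓝 0))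
    (h2 : ∀ᵐ ω ∂P, Tendsto (fun n => (φ n).integral W t ω) atTop (𝓝 (I ω))) :
    IsItoIntegral F P W H t I := by
  have hm : ∀ n, AEStronglyMeasurable ((φ n).integral W t) P :=
    fun n => ((φ n).memLp_integral hW t).1
  refine ⟨hH, aestronglyMeasurable_of_tendsto_ae atTop hm h2, φ, h1, ?_⟩
  refine tendsto_of_tendsto_of_tendsto_of_le_of_le tendsto_const_nhds h1
    (fun _ => zero_le) fun n => ?_
  -- Fix `n` and let `m → ∞`: the isometry bounds the distance between the `n`-th and `m`-th
  -- integrals by their integrands' distances to `H`, and Fatou passes to `I`.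
  refine eLpNorm_two_le_of_tendsto_ae
    (f := fun m ω => (φ n).integral W t ω - (φ m).integral W t ω) (fun m => (hm n).sub (hm m)) ?_
    (u := fun m => eLpNorm (fun p : ℝ × Ω => (φ n).eval p.1 p.2 - H p.1 p.2) 2
      ((volume.restrict (Set.Ioc (0 : ℝ) t)).prod P) +
      eLpNorm (fun p : ℝ × Ω => (φ m).eval p.1 p.2 - H p.1 p.2) 2
      ((volume.restrict (Set.Ioc (0 : ℝ) t)).prod P)) (by simpa using h1.const_add _) fun m => ?_
  · filter_upwards [h2] with ω hω using hω.const_sub _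
  · rw [(φ n).eLpNorm_integral_sub hW (φ m),
      eLpNorm_two_sub_comm (fun p : ℝ × Ω => (φ m).eval p.1 p.2)]
    exact eLpNorm_two_sub_le ((φ n).memLp_eval t).1 hH ((φ m).memLp_eval t).1

theorem IsItoIntegral.congr {H : ℝ → Ω → ℝ} {t : ℝ≥0} {I J : Ω → ℝ}
    (h : IsItoIntegral F P W H t I) (hIJ : I =ᵐ[P] J) : IsItoIntegral F P W H t J := by
  obtain ⟨hH, hI, φ, h1, h2⟩ := h
  refine ⟨hH, hI.congr hIJ, φ, h1, h2.congr fun n => eLpNorm_congr_ae ?_⟩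
  filter_upwards [hIJ] with ω hω
  rw [hω]

/-- Two approximating sequences of the same integrand are asymptotically equal in `L²`; by the
isometry so are their integrals. -/
theorem IsItoIntegral.ae_eq (hW : IsFBrownianMotion F P W) {H : ℝ → Ω → ℝ} {t : ℝ≥0} {I J : Ω → ℝ}
    (hI : IsItoIntegral F P W H t I) (hJ : IsItoIntegral F P W H t J) : I =ᵐ[P] J := by
  obtain ⟨hH, mI, φ, a1, a2⟩ := hI
  obtain ⟨-, mJ, ψ, b1, b2⟩ := hJ
  have key : ∀ n, eLpNorm (fun ω => I ω - J ω) 2 P ≤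
      (eLpNorm (fun ω => (φ n).integral W t ω - I ω) 2 P +
        (eLpNorm (fun p : ℝ × Ω => (φ n).eval p.1 p.2 - H p.1 p.2) 2
          ((volume.restrict (Set.Ioc (0 : ℝ) t)).prod P) +
        eLpNorm (fun p : ℝ × Ω => (ψ n).eval p.1 p.2 - H p.1 p.2) 2
          ((volume.restrict (Set.Ioc (0 : ℝ) t)).prod P))) +
        eLpNorm (fun ω => (ψ n).integral W t ω - J ω) 2 P := by
    intro n
    have m1 := ((φ n).memLp_integral hW t).1
    have m2 := ((ψ n).memLp_integral hW t).1
    refine (eLpNorm_two_sub_le mI m2 mJ).trans (add_le_add_left ?_ _)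
    refine (eLpNorm_two_sub_le mI m1 m2).trans ?_
    rw [eLpNorm_two_sub_comm I, (φ n).eLpNorm_integral_sub hW (ψ n),
      eLpNorm_two_sub_comm (fun p : ℝ × Ω => (ψ n).eval p.1 p.2)]
    exact add_le_add_right
      (eLpNorm_two_sub_le ((φ n).memLp_eval t).1 hH ((ψ n).memLp_eval t).1) _
  have h0 : eLpNorm (fun ω => I ω - J ω) 2 P = 0 := by
    have hlim := (a2.add (a1.add b1)).add b2
    simp only [add_zero] at hlim
    exact le_antisymm (ge_of_tendsto hlim (Eventually.of_forall key)) zero_le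
  have h1 := (eLpNorm_eq_zero_iff (mI.sub mJ) two_ne_zero).1 h0
  filter_upwards [h1] with ω hω
  exact sub_eq_zero.1 hω

theorem IsItoIntegral.eLpNorm_le (hW : IsFBrownianMotion F P W) {H : ℝ → Ω → ℝ} {t : ℝ≥0}
    {I : Ω → ℝ} (hI : IsItoIntegral F P W H t I) :
    eLpNorm I 2 P ≤ eLpNorm (fun p : ℝ × Ω => H p.1 p.2) 2
      ((volume.restrict (Set.Ioc (0 : ℝ) t)).prod P) := by
  obtain ⟨hH, mI, φ, a1, a2⟩ := hI
  have z : ∀ {β : Type _} {mβ : MeasurableSpace β} (ν : Measure β) (f g : β → ℝ),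
      AEStronglyMeasurable f ν → AEStronglyMeasurable g ν →
      eLpNorm f 2 ν ≤ eLpNorm (fun x => f x - g x) 2 ν + eLpNorm g 2 ν := by
    intro β mβ ν f g hf hg
    simpa using eLpNorm_two_sub_le hf hg (aestronglyMeasurable_const (b := (0 : ℝ)))
  refine ge_of_tendsto (x := atTop) (f := fun n =>
    eLpNorm (fun ω => (φ n).integral W t ω - I ω) 2 P +
      (eLpNorm (fun p : ℝ × Ω => (φ n).eval p.1 p.2 - H p.1 p.2) 2
        ((volume.restrict (Set.Ioc (0 : ℝ) t)).prod P) +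
      eLpNorm (fun p : ℝ × Ω => H p.1 p.2) 2 ((volume.restrict (Set.Ioc (0 : ℝ) t)).prod P)))
    ?_ (Eventually.of_forall fun n => ?_)
  · simpa using a2.add (a1.add_const _)
  · refine (z P I _ mI ((φ n).memLp_integral hW t).1).trans ?_
    rw [eLpNorm_two_sub_comm I, (φ n).eLpNorm_integral hW]
    exact add_le_add_right (z _ _ _ ((φ n).memLp_eval t).1 hH) _

/-- The Itô integral is closed under limits in `L²`. -/
theorem isItoIntegral_of_tendsto_eLpNorm (hW : IsFBrownianMotion F P W) {H : ℝ → Ω → ℝ} {t : ℝ≥0}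
    {I : Ω → ℝ} {G : ℕ → ℝ → Ω → ℝ} {J : ℕ → Ω → ℝ} (h : ∀ n, IsItoIntegral F P W (G n) t (J n))
    (hH : AEStronglyMeasurable (fun p : ℝ × Ω => H p.1 p.2)
      ((volume.restrict (Set.Ioc (0 : ℝ) t)).prod P))
    (hI : AEStronglyMeasurable I P)
    (h1 : Tendsto (fun n => eLpNorm (fun p : ℝ × Ω => G n p.1 p.2 - H p.1 p.2) 2
      ((volume.restrict (Set.Ioc (0 : ℝ) t)).prod P)) atTop (𝓝 0))
    (h2 : Tendsto (fun n => eLpNorm (fun ω => J n ω - I ω) 2 P) atTop (𝓝 0)) :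
    IsItoIntegral F P W H t I := by
  -- A diagonal choice: one elementary process close to `G n` whose integral is also close to `J n`.
  have ex : ∀ n : ℕ, ∃ φ : Elementary F,
      eLpNorm (fun p : ℝ × Ω => φ.eval p.1 p.2 - G n p.1 p.2) 2
        ((volume.restrict (Set.Ioc (0 : ℝ) t)).prod P) ≤ ((n : ℝ≥0∞) + 1)⁻¹ ∧
      eLpNorm (fun ω => φ.integral W t ω - J n ω) 2 P ≤ ((n : ℝ≥0∞) + 1)⁻¹ := by
    intro n
    obtain ⟨-, -, φ, a1, a2⟩ := h n
    have hpos : (0 : ℝ≥0∞) < ((n : ℝ≥0∞) + 1)⁻¹ := by simp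
    obtain ⟨m, hm1, hm2⟩ := ((a1.eventually (eventually_le_nhds hpos)).and
      (a2.eventually (eventually_le_nhds hpos))).exists
    exact ⟨φ m, hm1, hm2⟩
  choose φ hφ1 hφ2 using ex
  have hz : Tendsto (fun n : ℕ => ((n : ℝ≥0∞) + 1)⁻¹) atTop (𝓝 0) := by
    have := (tendsto_add_atTop_iff_nat 1).2 ENNReal.tendsto_inv_nat_nhds_zero
    simpa using this
  refine ⟨hH, hI, φ, ?_, ?_⟩
  · refine tendsto_of_tendsto_of_tendsto_of_le_of_le tendsto_const_nhds
      (by simpa using hz.add h1) (fun _ => zero_le) fun n => ?_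
    exact (eLpNorm_two_sub_le ((φ n).memLp_eval t).1 (h n).1 hH).trans
      (add_le_add_left (hφ1 n) _)
  · refine tendsto_of_tendsto_of_tendsto_of_le_of_le tendsto_const_nhds
      (by simpa using hz.add h2) (fun _ => zero_le) fun n => ?_
    exact (eLpNorm_two_sub_le ((φ n).memLp_integral hW t).1 (h n).2.1 hI).trans
      (add_le_add_left (hφ2 n) _)

/-- On a probability space `L¹` norms are dominated by `L²` norms, so `∑ |I n|` has finite
expectation. -/
theorem ae_summable_of_tsum_eLpNorm_two {I : ℕ → Ω → ℝ} (hI : ∀ n, AEStronglyMeasurable (I n) P)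
    (hs : ∑' n, eLpNorm (I n) 2 P ≠ ∞) : ∀ᵐ ω ∂P, Summable fun n => |I n ω| := by
  have h1 : ∫⁻ ω, ∑' n, ‖I n ω‖ₑ ∂P ≠ ∞ := by
    rw [lintegral_tsum fun n => (hI n).enorm]
    refine ne_top_of_le_ne_top hs (ENNReal.tsum_le_tsum fun n => ?_)
    rw [← eLpNorm_one_eq_lintegral_enorm]
    exact eLpNorm_le_eLpNorm_of_exponent_le one_le_two (hI n)
  filter_upwards [ae_lt_top' (AEMeasurable.tsum fun n => (hI n).enorm) h1] with ω hω
  have := ENNReal.tsum_coe_ne_top_iff_summable.1 hω.ne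
  exact (NNReal.summable_coe.2 this).congr fun n => Real.norm_eq_abs _

/-- Termwise integration of a series of processes whose `L²` norms are summable. -/
theorem isItoIntegral_tsum (hW : IsFBrownianMotion F P W) {H : ℝ → Ω → ℝ} {t : ℝ≥0}
    {G : ℕ → ℝ → Ω → ℝ} {I : ℕ → Ω → ℝ} (h : ∀ n, IsItoIntegral F P W (G n) t (I n))
    (hsum : ∀ N, IsItoIntegral F P W (fun s ω => ∑ n ∈ Finset.range N, G n s ω) t
      (fun ω => ∑ n ∈ Finset.range N, I n ω))
    (hs : ∑' n, eLpNorm (fun p : ℝ × Ω => G n p.1 p.2) 2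
      ((volume.restrict (Set.Ioc (0 : ℝ) t)).prod P) ≠ ∞)
    (hH : ∀ᵐ p : ℝ × Ω ∂((volume.restrict (Set.Ioc (0 : ℝ) t)).prod P),
      Tendsto (fun N => ∑ n ∈ Finset.range N, G n p.1 p.2) atTop (𝓝 (H p.1 p.2))) :
    (∀ᵐ ω ∂P, Summable fun n => |I n ω|) ∧ IsItoIntegral F P W H t (fun ω => ∑' n, I n ω) := by
  have hs' : ∑' n, eLpNorm (I n) 2 P ≠ ∞ :=
    ne_top_of_le_ne_top hs (ENNReal.tsum_le_tsum fun n => (h n).eLpNorm_le hW)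
  have hS := ae_summable_of_tsum_eLpNorm_two (fun n => (h n).2.1) hs'
  have hlim : ∀ᵐ ω ∂P, Tendsto (fun N => ∑ n ∈ Finset.range N, I n ω) atTop
      (𝓝 (∑' n, I n ω)) := by
    filter_upwards [hS] with ω hω using (Summable.of_abs hω).hasSum.tendsto_sum_nat
  refine ⟨hS, isItoIntegral_of_tendsto_eLpNorm hW hsum ?_ ?_ ?_ ?_⟩
  · exact aestronglyMeasurable_of_tendsto_ae atTop (fun N => (hsum N).1) hH
  · exact aestronglyMeasurable_of_tendsto_ae atTop (fun N => (hsum N).2.1) hlim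
  · exact tendsto_eLpNorm_two_sum_sub (fun n => (h n).1) hs hH
  · exact tendsto_eLpNorm_two_sum_sub (fun n => (h n).2.1) hs' hlim

end Ito

/-! ### Riemann–Stieltjes sums along partitions -/

section Partitions

variable {f f' v : ℝ → ℝ} {τ : ℕ → ℝ} {C ε : ℝ}

theorem abs_sub_le_of_abs_deriv_le (hf : ∀ x, HasDerivAt f (f' x) x) {a b x y : ℝ}
    (hC : ∀ x ∈ Set.Icc a b, |f' x| ≤ C) (hx : x ∈ Set.Icc a b) (hy : y ∈ Set.Icc a b) :
    |f y - f x| ≤ C * |y - x| := by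
  have := (convex_Icc a b).norm_image_sub_le_of_norm_hasDerivWithin_le
    (fun x _ => (hf x).hasDerivWithinAt) hC hx hy
  simpa using this

/-- On each cell the error of the left-point sum is exactly `∫ f' (v - v(right endpoint))`, so only
the oscillation of `v` matters; bounded variation of `v` is not needed. -/
theorem abs_sum_mul_sub_parts_le (hf : ∀ x, HasDerivAt f (f' x) x) (hf' : Continuous f')
    (hv : Continuous v) (hτ : Monotone τ) {m : ℕ}
    (hC : ∀ x ∈ Set.Icc (τ 0) (τ m), |f' x| ≤ C)
    (hε : ∀ k < m, ∀ s ∈ Set.Icc (τ k) (τ (k + 1)), |v s - v (τ (k + 1))| ≤ ε) :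
    |∑ k ∈ Finset.range m, f (τ k) * (v (τ (k + 1)) - v (τ k)) -
      (f (τ m) * v (τ m) - f (τ 0) * v (τ 0) - ∫ s in τ 0..τ m, f' s * v s)|
      ≤ ε * C * (τ m - τ 0) := by
  have hi : ∀ a b, IntervalIntegrable (fun s => f' s * v s) volume a b :=
    fun a b => (hf'.mul hv).intervalIntegrable a b
  have e1 : f (τ m) * v (τ m) - f (τ 0) * v (τ 0) - ∫ s in τ 0..τ m, f' s * v s
      = ∑ k ∈ Finset.range m, (f (τ (k + 1)) * v (τ (k + 1)) - f (τ k) * v (τ k)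
        - ∫ s in τ k..τ (k + 1), f' s * v s) := by
    rw [Finset.sum_sub_distrib, Finset.sum_range_sub (fun k => f (τ k) * v (τ k)),
      intervalIntegral.sum_integral_adjacent_intervals fun k _ => hi _ _]
  rw [e1, ← Finset.sum_sub_distrib, ← Finset.sum_range_sub τ, Finset.mul_sum]
  refine (Finset.abs_sum_le_sum_abs _ _).trans (Finset.sum_le_sum fun k hk => ?_)
  have hk := Finset.mem_range.1 hk
  have hk1 := hτ (Nat.le_succ k)
  have e2 : f (τ k) * (v (τ (k + 1)) - v (τ k)) - (f (τ (k + 1)) * v (τ (k + 1)) - f (τ k) * v (τ k)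
        - ∫ s in τ k..τ (k + 1), f' s * v s)
      = ∫ s in τ k..τ (k + 1), f' s * (v s - v (τ (k + 1))) := by
    have hi2 : IntervalIntegrable (fun s => f' s * v (τ (k + 1))) volume (τ k) (τ (k + 1)) :=
      (hf'.mul continuous_const).intervalIntegrable _ _
    simp_rw [mul_sub]
    rw [intervalIntegral.integral_sub (hi _ _) hi2, intervalIntegral.integral_mul_const,
      intervalIntegral.integral_eq_sub_of_hasDerivAt (fun x _ => hf x)
        (hf'.intervalIntegrable _ _)]
    ring
  rw [e2]
  have := intervalIntegral.norm_integral_le_of_norm_le_const (C := C * ε)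
    (f := fun s => f' s * (v s - v (τ (k + 1)))) (a := τ k) (b := τ (k + 1)) ?_
  · rwa [abs_of_nonneg (sub_nonneg.2 hk1), mul_comm C ε] at this
  · intro s hs
    rw [Set.uIoc_of_le hk1] at hs
    have hm : s ∈ Set.Icc (τ 0) (τ m) :=
      ⟨(hτ (Nat.zero_le k)).trans hs.1.le, hs.2.trans (hτ hk)⟩
    rw [norm_mul]
    exact mul_le_mul (hC s hm) (hε k hk s ⟨hs.1.le, hs.2⟩) (norm_nonneg _)
      ((abs_nonneg _).trans (hC s hm))

/-- Increments of `f` are at most `C` times the cell length, while those of `v` are at most `ε`. -/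
theorem abs_sum_sub_mul_sub_le (hf : ∀ x, HasDerivAt f (f' x) x) (hτ : Monotone τ) {m : ℕ}
    (hC : ∀ x ∈ Set.Icc (τ 0) (τ m), |f' x| ≤ C)
    (hε : ∀ k < m, ∀ s ∈ Set.Icc (τ k) (τ (k + 1)), |v s - v (τ (k + 1))| ≤ ε) :
    |∑ k ∈ Finset.range m, (f (τ (k + 1)) - f (τ k)) * (v (τ (k + 1)) - v (τ k))|
      ≤ ε * C * (τ m - τ 0) := by
  rw [← Finset.sum_range_sub τ, Finset.mul_sum]
  refine (Finset.abs_sum_le_sum_abs _ _).trans (Finset.sum_le_sum fun k hk => ?_)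
  have hk := Finset.mem_range.1 hk
  have hk1 := hτ (Nat.le_succ k)
  have hm : ∀ j ≤ m, τ j ∈ Set.Icc (τ 0) (τ m) := fun j hj => ⟨hτ (Nat.zero_le j), hτ hj⟩
  have h1 := abs_sub_le_of_abs_deriv_le hf hC (hm k hk.le) (hm (k + 1) hk)
  have h2 := hε k hk (τ k) ⟨le_rfl, hk1⟩
  rw [abs_of_nonneg (sub_nonneg.2 hk1)] at h1
  rw [abs_mul, abs_sub_comm (v _)]
  calc _ ≤ (C * (τ (k + 1) - τ k)) * ε :=
        mul_le_mul h1 h2 (abs_nonneg _) ((abs_nonneg _).trans h1)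
    _ = _ := by ring

/-- Along partitions of `[0, t]` whose mesh tends to zero, the oscillations of a continuous function
over the intervals of the partition tend to zero. -/
theorem eventually_oscillation_le {w : ℝ≥0 → ℝ} (hw : Continuous w) {t : ℝ≥0} {m : ℕ → ℕ}
    {τ : ℕ → ℕ → ℝ≥0} (hτ : ∀ n, Monotone (τ n)) (hτt : ∀ n, τ n (m n) = t)
    (hmesh : ∀ δ : ℝ≥0, 0 < δ → ∀ᶠ n in atTop, ∀ k < m n, τ n (k + 1) - τ n k < δ)
    (hε : 0 < ε) : ∀ᶠ n in atTop, ∀ k < m n, ∀ s ∈ Set.Icc (τ n k : ℝ) (τ n (k + 1)),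
      |w s.toNNReal - w (τ n (k + 1))| ≤ ε := by
  have hu := (isCompact_Icc (a := (0 : ℝ≥0)) (b := t)).uniformContinuousOn_of_continuous
    hw.continuousOn
  obtain ⟨δ, hδ, h⟩ := Metric.uniformContinuousOn_iff.1 hu ε hε
  filter_upwards [hmesh ⟨δ, hδ.le⟩ hδ] with n hn k hk s hs
  have hs0 : (0 : ℝ) ≤ s := (τ n k).coe_nonneg.trans hs.1
  have h1 : s.toNNReal ≤ τ n (k + 1) := Real.toNNReal_le_iff_le_coe.2 hs.2
  have h2 : τ n (k + 1) ≤ t := hτt n ▸ hτ n hk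
  refine (h _ ⟨zero_le, h1.trans h2⟩ _ ⟨zero_le, h2⟩ ?_).le
  have h3 : ((τ n (k + 1) - τ n k : ℝ≥0) : ℝ) < δ := hn k hk
  rw [NNReal.coe_sub (hτ n (Nat.le_succ k))] at h3
  rw [NNReal.dist_eq, Real.coe_toNNReal _ hs0, abs_sub_comm,
    abs_of_nonneg (sub_nonneg.2 hs.2)]
  linarith [hs.1]

/-- Integration by parts, the pathwise definition of `∫_0^t f dw` for smooth `f`. -/
noncomputable def integralByParts (f f' : ℝ → ℝ) (w : ℝ≥0 → ℝ) (t : ℝ≥0) : ℝ :=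
  f t * w t - f 0 * w 0 - ∫ s in (0 : ℝ)..t, f' s * w s.toNNReal

theorem continuous_integralByParts (hf : ∀ x, HasDerivAt f (f' x) x) (hf' : Continuous f')
    {w : ℝ≥0 → ℝ} (hw : Continuous w) : Continuous (integralByParts f f' w) := by
  have hfc : Continuous f := continuous_iff_continuousAt.2 fun x => (hf x).continuousAt
  have h1 : Continuous fun x : ℝ => ∫ s in (0 : ℝ)..x, f' s * w s.toNNReal :=
    intervalIntegral.continuous_primitive (fun a b =>
      (hf'.mul (hw.comp continuous_real_toNNReal)).intervalIntegrable a b) 0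
  exact (((hfc.comp NNReal.continuous_coe).mul hw).sub continuous_const).sub
    (h1.comp NNReal.continuous_coe)

theorem tendsto_of_eventually_abs_sub_le {u : ℕ → ℝ} {a D : ℝ} (hD : 0 ≤ D)
    (h : ∀ ε > 0, ∀ᶠ n in atTop, |u n - a| ≤ ε * D) : Tendsto u atTop (𝓝 a) := by
  rw [Metric.tendsto_nhds]
  intro ε hε
  have hp : 0 < ε / (2 * (D + 1)) := by positivity
  filter_upwards [h _ hp] with n hn
  rw [Real.dist_eq]
  refine hn.trans_lt ?_
  rw [div_mul_eq_mul_div, div_lt_iff₀ (by positivity)]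
  nlinarith

theorem exists_abs_le_Icc (hf' : Continuous f') (t : ℝ≥0) :
    ∃ C, 0 ≤ C ∧ ∀ x ∈ Set.Icc (0 : ℝ) t, |f' x| ≤ C := by
  obtain ⟨C, hC⟩ := (isCompact_Icc (a := (0 : ℝ)) (b := t)).exists_bound_of_continuousOn
    hf'.continuousOn
  exact ⟨C, (norm_nonneg _).trans (hC 0 ⟨le_rfl, t.coe_nonneg⟩), hC⟩

theorem tendsto_sum_integralByParts (hf : ∀ x, HasDerivAt f (f' x) x) (hf' : Continuous f')
    {w : ℝ≥0 → ℝ} (hw : Continuous w) {t : ℝ≥0} {m : ℕ → ℕ} {τ : ℕ → ℕ → ℝ≥0}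
    (hτ : ∀ n, Monotone (τ n)) (hτ0 : ∀ n, τ n 0 = 0) (hτt : ∀ n, τ n (m n) = t)
    (hmesh : ∀ δ : ℝ≥0, 0 < δ → ∀ᶠ n in atTop, ∀ k < m n, τ n (k + 1) - τ n k < δ) :
    Tendsto (fun n => ∑ k ∈ Finset.range (m n), f (τ n k) * (w (τ n (k + 1)) - w (τ n k))) atTop
      (𝓝 (integralByParts f f' w t)) := by
  obtain ⟨C, hC0, hC⟩ := exists_abs_le_Icc hf' t
  refine tendsto_of_eventually_abs_sub_le (D := C * t) (by positivity) fun ε hε => ?_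
  filter_upwards [eventually_oscillation_le hw hτ hτt hmesh hε] with n hn
  have := abs_sum_mul_sub_parts_le (τ := fun k => (τ n k : ℝ)) (v := fun s => w s.toNNReal)
    hf hf' (hw.comp continuous_real_toNNReal) (fun i j h => NNReal.coe_le_coe.2 (hτ n h))
    (m := m n) (C := C) (ε := ε) (by simpa [hτ0, hτt] using hC) (by simpa using hn)
  simpa [hτ0, hτt, integralByParts, mul_assoc] using this

theorem tendsto_sum_covariation (hf : ∀ x, HasDerivAt f (f' x) x) (hf' : Continuous f')
    {w : ℝ≥0 → ℝ} (hw : Continuous w) {t : ℝ≥0} {m : ℕ → ℕ} {τ : ℕ → ℕ → ℝ≥0}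
    (hτ : ∀ n, Monotone (τ n)) (hτ0 : ∀ n, τ n 0 = 0) (hτt : ∀ n, τ n (m n) = t)
    (hmesh : ∀ δ : ℝ≥0, 0 < δ → ∀ᶠ n in atTop, ∀ k < m n, τ n (k + 1) - τ n k < δ) :
    Tendsto (fun n => ∑ k ∈ Finset.range (m n),
      (f (τ n (k + 1)) - f (τ n k)) * (w (τ n (k + 1)) - w (τ n k))) atTop (𝓝 0) := by
  obtain ⟨C, hC0, hC⟩ := exists_abs_le_Icc hf' t
  refine tendsto_of_eventually_abs_sub_le (D := C * t) (by positivity) fun ε hε => ?_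
  filter_upwards [eventually_oscillation_le hw hτ hτt hmesh hε] with n hn
  have := abs_sum_sub_mul_sub_le (τ := fun k => (τ n k : ℝ)) (v := fun s => w s.toNNReal)
    hf (fun i j h => NNReal.coe_le_coe.2 (hτ n h))
    (m := m n) (C := C) (ε := ε) (by simpa [hτ0, hτt] using hC) (by simpa using hn)
  simpa [hτ0, hτt, mul_assoc] using this

/-- The points of the partition of `[0, t]` into `n + 1` intervals of equal length. -/
noncomputable def uniformPartition (t : ℝ≥0) (n k : ℕ) : ℝ≥0 := k * (t / (n + 1))

theorem uniformPartition_mono (t : ℝ≥0) (n : ℕ) : Monotone (uniformPartition t n) :=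
  fun _ _ h => mul_le_mul_of_nonneg_right (Nat.cast_le.2 h) zero_le

theorem uniformPartition_zero (t : ℝ≥0) (n : ℕ) : uniformPartition t n 0 = 0 := by
  simp [uniformPartition]

theorem uniformPartition_last (t : ℝ≥0) (n : ℕ) : uniformPartition t n (n + 1) = t := by
  simp only [uniformPartition, Nat.cast_add, Nat.cast_one]
  exact mul_div_cancel₀ t (by positivity)

theorem uniformPartition_succ (t : ℝ≥0) (n k : ℕ) :
    uniformPartition t n (k + 1) = uniformPartition t n k + t / (n + 1) := by
  simp only [uniformPartition, Nat.cast_add, Nat.cast_one, add_mul, one_mul]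

theorem tendsto_const_div_succ (t : ℝ) : Tendsto (fun n : ℕ => t / ((n : ℝ) + 1)) atTop (𝓝 0) :=
  tendsto_const_nhds.div_atTop (tendsto_atTop_add_const_right _ 1 tendsto_natCast_atTop_atTop)

theorem uniformPartition_mesh (t δ : ℝ≥0) (hδ : 0 < δ) : ∀ᶠ n in atTop, ∀ k < n + 1,
    uniformPartition t n (k + 1) - uniformPartition t n k < δ := by
  have h := (tendsto_const_div_succ t).eventually (gt_mem_nhds (NNReal.coe_pos.2 hδ))
  filter_upwards [h] with n hn k _
  rw [uniformPartition_succ, add_tsub_cancel_left]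
  exact_mod_cast hn

end Partitions

/-! ### Smooth deterministic integrands -/

section Smooth

variable {Ω : Type*} {mΩ : MeasurableSpace Ω} {P : Measure Ω} [IsProbabilityMeasure P]
  {F : Filtration ℝ≥0 mΩ} {W : ℝ≥0 → Ω → ℝ} {f f' : ℝ → ℝ}

/-- The step function that samples `f` at the points of the uniform partition of `[0, t]`. -/
noncomputable def Elementary.sample (F : Filtration ℝ≥0 mΩ) (f : ℝ → ℝ) (t : ℝ≥0) (n : ℕ) :
    Elementary F where
  m := n + 1
  τ := uniformPartition t n
  mono := uniformPartition_mono t n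
  ξ := fun k _ => f (uniformPartition t n k)
  meas := fun _ => stronglyMeasurable_const
  bdd := fun k => ⟨|f (uniformPartition t n k)|, fun _ => le_rfl⟩

theorem sum_indicator_Ioc {τ : ℕ → ℝ} (hτ : Monotone τ) (m : ℕ) (s : ℝ) :
    ∑ k ∈ Finset.range m, (Set.Ioc (τ k) (τ (k + 1))).indicator (fun _ => (1 : ℝ)) s
      = (Set.Ioc (τ 0) (τ m)).indicator (fun _ => (1 : ℝ)) s := by
  induction m with
  | zero => simp
  | succ m ih =>
    rw [Finset.sum_range_succ, ih]
    have h1 := hτ (Nat.zero_le m)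
    have h2 := hτ (Nat.le_succ m)
    simp only [Set.indicator_apply, Set.mem_Ioc, Nat.succ_eq_add_one] at *
    split_ifs <;> grind

theorem Elementary.abs_sample_eval_sub_le (hf : ∀ x, HasDerivAt f (f' x) x) {t : ℝ≥0} {C : ℝ}
    (hC : ∀ x ∈ Set.Icc (0 : ℝ) t, |f' x| ≤ C) (n : ℕ) {s : ℝ} (hs : s ∈ Set.Ioc (0 : ℝ) t)
    (ω : Ω) : |(Elementary.sample F f t n).eval s ω - f s| ≤ C * (t / (n + 1)) := by
  set τ := fun k => (uniformPartition t n k : ℝ) with hτ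
  have hC0 : 0 ≤ C := (abs_nonneg _).trans (hC s ⟨hs.1.le, hs.2⟩)
  -- Exactly one cell contains `s`; the indicators sum to one, so the error and its bound can be
  -- compared cell by cell.
  have h1 : ∑ k ∈ Finset.range (n + 1), (Set.Ioc (τ k) (τ (k + 1))).indicator (fun _ => (1 : ℝ)) s
      = 1 := by
    rw [sum_indicator_Ioc (fun i j h => NNReal.coe_le_coe.2 (uniformPartition_mono t n h))]
    simp [uniformPartition_zero, uniformPartition_last, hs]
  have h2 : (Elementary.sample F f t n).eval s ω - f s = ∑ k ∈ Finset.range (n + 1),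
      (Set.Ioc (τ k) (τ (k + 1))).indicator (fun _ => (1 : ℝ)) s * (f (τ k) - f s) := by
    simp_rw [mul_sub]
    rw [Finset.sum_sub_distrib, ← Finset.sum_mul, h1, one_mul, Elementary.eval_eq]
    rfl
  have h3 : C * (t / (n + 1)) = ∑ k ∈ Finset.range (n + 1),
      (Set.Ioc (τ k) (τ (k + 1))).indicator (fun _ => (1 : ℝ)) s * (C * (t / (n + 1))) := by
    rw [← Finset.sum_mul, h1, one_mul]
  rw [h2, h3]
  refine (Finset.abs_sum_le_sum_abs _ _).trans (Finset.sum_le_sum fun k hk => ?_)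
  simp only [Set.indicator_apply]
  split_ifs with hk2
  · rw [one_mul, one_mul]
    have hk3 : τ (k + 1) = τ k + t / (n + 1) := by
      simp only [hτ, uniformPartition_succ]; push_cast; rfl
    refine (abs_sub_le_of_abs_deriv_le hf hC ⟨hs.1.le, hs.2⟩
      ⟨NNReal.coe_nonneg _, hk2.1.le.trans hs.2⟩).trans (mul_le_mul_of_nonneg_left ?_ hC0)
    rw [abs_sub_comm, abs_of_nonneg (sub_nonneg.2 hk2.1.le)]
    linarith [hk2.2]
  · simp

/-- Sampling on uniform grids converges to `f` uniformly on `(0, t]`, hence in `L²`, and the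
elementary integrals are left-point sums that converge along every continuous path. -/
theorem isItoIntegral_integralByParts (hW : IsFBrownianMotion F P W)
    (hf : ∀ x, HasDerivAt f (f' x) x) (hf' : Continuous f') (t : ℝ≥0) :
    IsItoIntegral F P W (fun s _ => f s) t (fun ω => integralByParts f f' (W · ω) t) := by
  have hfc : Continuous f := continuous_iff_continuousAt.2 fun x => (hf x).continuousAt
  obtain ⟨C, hC0, hC⟩ := exists_abs_le_Icc hf' t
  refine isItoIntegral_of_tendsto_ae hW (Elementary.sample F f t)
    (hfc.measurable.comp measurable_fst).aestronglyMeasurable ?_ ?_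
  · have hb : ∀ n : ℕ, eLpNorm (fun p : ℝ × Ω => (Elementary.sample F f t n).eval p.1 p.2 - f p.1) 2
        ((volume.restrict (Set.Ioc (0 : ℝ) t)).prod P) ≤
        ((volume.restrict (Set.Ioc (0 : ℝ) t)).prod P) Set.univ ^ (2 : ℝ≥0∞).toReal⁻¹ *
          ENNReal.ofReal (C * (t / (n + 1))) := by
      intro n
      refine eLpNorm_le_of_ae_bound ?_
      filter_upwards [Measure.quasiMeasurePreserving_fst.ae
        (ae_restrict_mem (μ := volume) (measurableSet_Ioc (a := (0 : ℝ)) (b := t)))] with p hp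
      exact Elementary.abs_sample_eval_sub_le hf hC n hp p.2
    refine tendsto_of_tendsto_of_tendsto_of_le_of_le tendsto_const_nhds ?_
      (fun _ => zero_le) hb
    have h1 : Tendsto (fun n : ℕ => ENNReal.ofReal (C * ((t : ℝ) / (n + 1)))) atTop (𝓝 0) := by
      have := ENNReal.tendsto_ofReal ((tendsto_const_div_succ t).const_mul C)
      simpa using this
    have h2 := ENNReal.Tendsto.const_mul h1 (a := ((volume.restrict (Set.Ioc (0 : ℝ) t)).prod P)
      Set.univ ^ (2 : ℝ≥0∞).toReal⁻¹) (Or.inr (ENNReal.rpow_ne_top_of_nonneg (by positivity)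
        (measure_ne_top _ _)))
    simpa using h2
  · filter_upwards [hW.isBrownian.cont] with ω hω
    refine (tendsto_sum_integralByParts hf hf' hω (m := fun n => n + 1)
      (uniformPartition_mono t) (uniformPartition_zero t) (uniformPartition_last t)
      (uniformPartition_mesh t)).congr fun n => Finset.sum_congr rfl fun k hk => ?_
    have hle : ∀ j ≤ n + 1, min (uniformPartition t n j) t = uniformPartition t n j := fun j hj =>
      min_eq_left ((uniformPartition_mono t n hj).trans (uniformPartition_last t n).le)
    have hk := Finset.mem_range.1 hk
    simp only [Elementary.sample, hle k hk.le, hle (k + 1) hk]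

theorem isCovariation_smooth (hW : IsFBrownianMotion F P W)
    (hf : ∀ x, HasDerivAt f (f' x) x) (hf' : Continuous f') (t : ℝ≥0) :
    IsCovariation P (fun s _ => f s) W t 0 := by
  refine ⟨aestronglyMeasurable_const, fun m τ h1 h2 h3 h4 => ?_⟩
  refine tendstoInMeasure_of_tendsto_ae (fun n => ?_) ?_
  · exact Finset.aestronglyMeasurable_fun_sum _ fun k _ =>
      aestronglyMeasurable_const.mul (hW.memLp_sub _ _).1
  · filter_upwards [hW.isBrownian.cont] with ω hω
    exact tendsto_sum_covariation hf hf' hω h1 h2 h3 h4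

theorem IsCovariation.ae_eq {Y : ℝ≥0 → Ω → ℝ} {t : ℝ≥0} {C D : Ω → ℝ}
    (hC : IsCovariation P Y W t C) (hD : IsCovariation P Y W t D) : C =ᵐ[P] D :=
  tendstoInMeasure_ae_unique
    (hC.2 (fun n => n + 1) (uniformPartition t) (uniformPartition_mono t) (uniformPartition_zero t)
      (uniformPartition_last t) (uniformPartition_mesh t))
    (hD.2 (fun n => n + 1) (uniformPartition t) (uniformPartition_mono t) (uniformPartition_zero t)
      (uniformPartition_last t) (uniformPartition_mesh t))

/-- Integration by parts is a continuous version with zero covariation term, so the choice in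
`stratonovich` is not the default `0`. Uniqueness of the Itô integral and of the covariation
identifies the chosen version at time `t`. -/
theorem stratonovich_ae_eq (hW : IsFBrownianMotion F P W)
    (hf : ∀ x, HasDerivAt f (f' x) x) (hf' : Continuous f') (t : ℝ≥0) :
    stratonovich F P W (fun s _ => f s) t =ᵐ[P] fun ω => integralByParts f f' (W · ω) t := by
  have hito : ∀ t : ℝ≥0, IsItoIntegral F P W (fun s _ => f s.toNNReal) t
      (fun ω => integralByParts f f' (W · ω) t) := by
    intro t
    have hae : ∀ᵐ p : ℝ × Ω ∂((volume.restrict (Set.Ioc (0 : ℝ) t)).prod P),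
        f p.1 = f p.1.toNNReal := by
      filter_upwards [Measure.quasiMeasurePreserving_fst.ae
        (ae_restrict_mem (μ := volume) (measurableSet_Ioc (a := (0 : ℝ)) (b := t)))] with p hp
      rw [Real.coe_toNNReal _ hp.1.le]
    obtain ⟨h1, h2, φ, h3, h4⟩ := isItoIntegral_integralByParts hW hf hf' t
    refine ⟨h1.congr hae, h2, φ, h3.congr fun n => eLpNorm_congr_ae ?_, h4⟩
    filter_upwards [hae] with p hp
    rw [hp]
  have hex : ∃ Z : ℝ≥0 → Ω → ℝ, (∀ᵐ ω ∂P, Continuous fun t => Z t ω) ∧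
      ∀ t, IsStratonovichIntegral F P W (fun s _ => f s) t (Z t) := by
    refine ⟨fun t ω => integralByParts f f' (W · ω) t, ?_, fun t => ⟨_, 0, hito t,
      isCovariation_smooth hW hf hf' t, Eventually.of_forall fun ω => by simp⟩⟩
    filter_upwards [hW.isBrownian.cont] with ω hω
    exact continuous_integralByParts hf hf' hω
  have hdef : stratonovich F P W (fun s _ => f s) = hex.choose := by
    unfold stratonovich
    rw [dif_pos hex]
  obtain ⟨I, C, hI, hC, hZ⟩ := hex.choose_spec.2 t
  rw [hdef]
  filter_upwards [hZ, hI.ae_eq hW (hito t), hC.ae_eq (isCovariation_smooth hW hf hf' t)]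
    with ω h1 h2 h3
  rw [h1, h2, h3]
  simp

end Smooth

/-! ### Taylor expansion of the kernel -/

section Taylor

/-- Taylor's formula works with derivatives within the segment from `t` to `x`, whereas the
coefficients use derivatives within `(0, T]`. -/
theorem iteratedDerivWithin_eq_of_subset {K : ℝ → ℝ} {s s' : Set ℝ} (h : s ⊆ s')
    (hs : UniqueDiffOn ℝ s) (hs' : UniqueDiffOn ℝ s') (hK : ContDiffOn ℝ (⊤ : ℕ∞) K s') (n : ℕ)
    {x : ℝ} (hx : x ∈ s) : iteratedDerivWithin n K s x = iteratedDerivWithin n K s' x := by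
  unfold iteratedDerivWithin
  rw [iteratedFDerivWithin_subset h hs hs' (hK.of_le (by exact_mod_cast le_top)) hx]

/-- The integrand `|K⁽ⁿ⁺¹⁾(u)| (u - x)ⁿ/n!` is compared with the term of index `n + 1` of the
weighted series at `u`. The quotient is `(n + 1) √(2n + 3) ((u - x)/u)ⁿ u^(-3/2)`; then `√(2n + 3) ≤
2n + 3`, `u ≥ x`, and `(u - x)/u` is increasing in `u`. -/
theorem enorm_taylor_remainder_le {K : ℝ → ℝ} {T t x : ℝ} (hK : VolterraKernel T K) (hx : 0 < x)
    (hxt : x < t) (htT : t ≤ T) (n : ℕ) :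
    ‖K x - ∑ k ∈ Finset.range (n + 1), kernelDeriv T K k t * ((x - t) ^ k / (k.factorial : ℝ))‖ₑ
      ≤ ENNReal.ofReal (((n : ℝ) + 1) * (2 * n + 3) * ((t - x) / t) ^ n / x ^ (3 / 2 : ℝ)) *
        ∫⁻ u in Set.Ioc 0 T, weightedSeries T K u := by
  have ht : 0 < t := hx.trans hxt
  have hsub : Set.uIcc t x ⊆ Set.Ioc 0 T := by
    rw [Set.uIcc_of_ge hxt.le]
    exact fun u hu => ⟨hx.trans_le hu.1, hu.2.trans htT⟩
  have hU : UniqueDiffOn ℝ (Set.uIcc t x) := uniqueDiffOn_uIcc hxt.ne'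
  have heq : ∀ k, ∀ u ∈ Set.uIcc t x,
      iteratedDerivWithin k K (Set.uIcc t x) u = kernelDeriv T K k u := fun k u hu =>
    iteratedDerivWithin_eq_of_subset hsub hU (uniqueDiffOn_Ioc 0 T) hK.smooth k hu
  have h1 := taylor_integral_remainder (f := K) (x := x) (x₀ := t) (n := n)
    ((hK.smooth.mono hsub).of_le (by exact_mod_cast le_top))
  rw [taylor_within_apply] at h1
  have h2 : ∑ k ∈ Finset.range (n + 1), (((k.factorial : ℝ))⁻¹ * (x - t) ^ k) •
      iteratedDerivWithin k K (Set.uIcc t x) t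
      = ∑ k ∈ Finset.range (n + 1), kernelDeriv T K k t * ((x - t) ^ k / (k.factorial : ℝ)) := by
    refine Finset.sum_congr rfl fun k _ => ?_
    rw [heq k t Set.left_mem_uIcc, smul_eq_mul]
    ring
  rw [h2] at h1
  rw [h1, intervalIntegral.integral_of_ge hxt.le, enorm_neg]
  refine (enorm_integral_le_lintegral_enorm _).trans ?_
  rw [← lintegral_const_mul' _ _ ENNReal.ofReal_ne_top]
  refine (setLIntegral_mono' measurableSet_Ioc fun u hu => ?_).trans
    (lintegral_mono_set (Set.Ioc_subset_Ioc hx.le htT))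
  rw [heq (n + 1) u (by rw [Set.uIcc_of_ge hxt.le]; exact ⟨hu.1.le, hu.2⟩)]
  refine le_trans ?_ (mul_le_mul_right (ENNReal.le_tsum (n + 1)) _)
  have hu0 : 0 < u := hx.trans hu.1
  rw [← ENNReal.ofReal_mul (by have := sub_pos.2 hxt; positivity), ← ofReal_norm]
  refine ENNReal.ofReal_le_ofReal ?_
  rw [smul_eq_mul, norm_mul, norm_div, norm_pow, Real.norm_eq_abs,
    Real.norm_eq_abs (kernelDeriv _ _ _ _), abs_sub_comm, abs_of_pos (sub_pos.2 hu.1), RCLike.norm_natCast]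
  have hr : u - x ≤ (t - x) / t * u := by
    rw [div_mul_eq_mul_div, le_div_iff₀ ht]
    nlinarith [hu.2]
  have hpow : (u - x) ^ n ≤ ((t - x) / t) ^ n * u ^ n := by
    rw [← mul_pow]
    exact pow_le_pow_left₀ (sub_pos.2 hu.1).le hr n
  have hupow : u ^ (((n + 1 : ℕ) : ℝ) + 1 / 2) = u ^ n * u ^ (3 / 2 : ℝ) := by
    rw [← Real.rpow_natCast, ← Real.rpow_add hu0]
    congr 1; push_cast; ring
  have hx32 : x ^ (3 / 2 : ℝ) ≤ u ^ (3 / 2 : ℝ) :=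
    Real.rpow_le_rpow hx.le hu.1.le (by norm_num)
  have hx0 : 0 < x ^ (3 / 2 : ℝ) := Real.rpow_pos_of_pos hx _
  have hs0 : 0 < √(2 * ((n + 1 : ℕ) : ℝ) + 1) := Real.sqrt_pos.2 (by positivity)
  have hsq : √(2 * ((n + 1 : ℕ) : ℝ) + 1) ≤ 2 * n + 3 := by
    rw [Real.sqrt_le_left (by positivity)]
    push_cast
    nlinarith [(Nat.cast_nonneg n : (0 : ℝ) ≤ n)]
  rw [hupow, Nat.factorial_succ]
  push_cast at hsq hs0 ⊢
  set D := |kernelDeriv T K (n + 1) u| with hD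
  set q := ((t - x) / t) ^ n with hq
  have hq0 : 0 ≤ q := by have := sub_pos.2 hxt; positivity
  have hf0 : (0 : ℝ) < n.factorial := by positivity
  have e : ((n : ℝ) + 1) * (2 * n + 3) * q / x ^ (3 / 2 : ℝ) *
      (D * (u ^ n * u ^ (3 / 2 : ℝ)) / (((n : ℝ) + 1) * n.factorial * √(2 * ((n : ℝ) + 1) + 1)))
      = (q * u ^ n / n.factorial * D) * (((2 * n + 3) / √(2 * ((n : ℝ) + 1) + 1)) *
        (u ^ (3 / 2 : ℝ) / x ^ (3 / 2 : ℝ))) := by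
    field_simp
  rw [e]
  calc (u - x) ^ n / n.factorial * D ≤ q * u ^ n / n.factorial * D := by gcongr
    _ ≤ _ := le_mul_of_one_le_right (by positivity)
      (one_le_mul_of_one_le_of_one_le ((one_le_div hs0).2 hsq) ((one_le_div hx0).2 hx32))

theorem tendsto_poly_mul_pow {r : ℝ} (h0 : 0 ≤ r) (h1 : r < 1) :
    Tendsto (fun n : ℕ => ((n : ℝ) + 1) * (2 * n + 3) * r ^ n) atTop (𝓝 0) := by
  have h : |r| < 1 := by rwa [abs_of_nonneg h0]
  have a := tendsto_pow_const_mul_const_pow_of_abs_lt_one 2 h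
  have b := tendsto_pow_const_mul_const_pow_of_abs_lt_one 1 h
  have c := tendsto_pow_const_mul_const_pow_of_abs_lt_one 0 h
  have := ((a.const_mul 2).add (b.const_mul 5)).add (c.const_mul 3)
  simp only [mul_zero, add_zero] at this
  refine this.congr fun n => ?_
  ring

/-- The Taylor series of the kernel at `t` represents the kernel on `(0, t]`. -/
theorem VolterraKernel.tendsto_taylor {K : ℝ → ℝ} {T t s : ℝ} (hK : VolterraKernel T K)
    (hs : 0 < s) (hst : s < t) (htT : t ≤ T) :
    Tendsto (fun N => ∑ k ∈ Finset.range N,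
      kernelDeriv T K k t * (-1) ^ k * (s ^ k / (k.factorial : ℝ))) atTop (𝓝 (K (t - s))) := by
  -- The remainder bound concerns sums of `n + 1` terms. With `x = t - s` its geometric ratio is
  -- `s/t < 1`.
  rw [← tendsto_add_atTop_iff_nat 1, tendsto_iff_edist_tendsto_0]
  have hx : 0 < t - s := sub_pos.2 hst
  have ht : 0 < t := hs.trans hst
  have hlim : Tendsto (fun n : ℕ => ENNReal.ofReal (((n : ℝ) + 1) * (2 * n + 3) *
      ((t - (t - s)) / t) ^ n / (t - s) ^ (3 / 2 : ℝ)) *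
        ∫⁻ u in Set.Ioc 0 T, weightedSeries T K u) atTop (𝓝 0) := by
    have h1 := (tendsto_poly_mul_pow (r := (t - (t - s)) / t) (by rw [sub_sub_cancel]; positivity)
      (by rw [sub_sub_cancel, div_lt_one ht]; exact hst)).div_const ((t - s) ^ (3 / 2 : ℝ))
    have h2 := ENNReal.Tendsto.mul_const (ENNReal.tendsto_ofReal h1)
      (Or.inr hK.lintegral_series_lt_top.ne)
    simpa using h2
  refine tendsto_of_tendsto_of_tendsto_of_le_of_le tendsto_const_nhds hlim
    (fun _ => zero_le) fun n => ?_
  refine le_trans (le_of_eq ?_) (enorm_taylor_remainder_le hK hx (by linarith) htT n)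
  rw [edist_comm, edist_eq_enorm_sub]
  congr 2
  refine Finset.sum_congr rfl fun k _ => ?_
  rw [sub_sub_cancel_left, neg_pow s]
  ring

end Taylor

/-! ### Coefficients and words -/

section Words

/-- The word consisting of `n` letters of time followed by one letter of noise. -/
def timeNoiseWord (n : ℕ) : Word 2 := List.replicate n (0 : Fin 2) ++ [1]

theorem length_timeNoiseWord (n : ℕ) : (timeNoiseWord n).length = n + 1 := by
  simp [timeNoiseWord]

/-- The defining series converges coordinatewise, since a word `u` can only meet the index `u.length
- 1`. For the empty word the truncated index is `0`, but the indicator is zero. -/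
theorem volterraCoeff_apply {T t : ℝ} (K : ℝ → ℝ) (ht : t ∈ Set.Ioc 0 T) (u : Word 2) :
    volterraCoeff T K t u = kernelDeriv T K (u.length - 1) t * (-1) ^ (u.length - 1) *
      (if u = timeNoiseWord (u.length - 1) then 1 else 0) := by
  have key : ∀ u : Word 2, HasSum (fun n : ℕ => ((kernelDeriv T K n t * (-1) ^ n) •
      ofWord (timeNoiseWord n)) u) (kernelDeriv T K (u.length - 1) t * (-1) ^ (u.length - 1) *
      (if u = timeNoiseWord (u.length - 1) then 1 else 0)) := by
    intro u
    have h := hasSum_single (f := fun n : ℕ => ((kernelDeriv T K n t * (-1) ^ n) •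
      ofWord (timeNoiseWord n)) u) (u.length - 1) ?_
    · convert h using 1
      simp [ofWord, Pi.single_apply]
    · intro n hn
      have : u ≠ timeNoiseWord n := by
        rintro rfl
        rw [length_timeNoiseWord] at hn
        exact hn rfl
      simp [ofWord, this]
  have h2 := Pi.hasSum.2 key
  unfold volterraCoeff
  rw [if_pos ht]
  exact congrFun h2.tsum_eq u

theorem level_zero_volterraCoeff {T t : ℝ} (K : ℝ → ℝ) (ht : t ∈ Set.Ioc 0 T) (p : ExtTensor 2) :
    level (volterraCoeff T K t) p 0 = 0 := by
  unfold level
  refine Finset.sum_eq_zero fun v _ => ?_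
  rw [volterraCoeff_apply K ht]
  simp [timeNoiseWord]

theorem level_succ_volterraCoeff {T t : ℝ} (K : ℝ → ℝ) (ht : t ∈ Set.Ioc 0 T) (p : ExtTensor 2)
    (n : ℕ) : level (volterraCoeff T K t) p (n + 1)
      = kernelDeriv T K n t * (-1) ^ n * p (timeNoiseWord n) := by
  obtain ⟨v, hv⟩ : ∃ v : Fin (n + 1) → Fin 2, List.ofFn v = timeNoiseWord n := by
    refine ⟨fun i => (timeNoiseWord n).get (i.cast (length_timeNoiseWord n).symm), ?_⟩
    refine List.ext_getElem (by simp [length_timeNoiseWord]) fun i h1 h2 => ?_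
    rw [List.getElem_ofFn]
    rfl
  unfold level
  rw [Finset.sum_eq_single v]
  · rw [volterraCoeff_apply K ht, hv, length_timeNoiseWord]
    simp
  · intro u _ hu
    rw [volterraCoeff_apply K ht, List.length_ofFn, Nat.add_sub_cancel, if_neg]
    · simp
    · rw [← hv]
      exact fun h => hu (List.ofFn_injective h)
  · simp

theorem volterraCoeff_of_notMem {T t : ℝ} (K : ℝ → ℝ) (ht : t ∉ Set.Ioc 0 T) :
    volterraCoeff T K t = 0 := by
  unfold volterraCoeff
  rw [if_neg ht]

end Words

/-! ### The Volterra process as a linear functional of the signature -/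

section Representation

variable {Ω : Type*} {mΩ : MeasurableSpace Ω} {P : Measure Ω} [IsProbabilityMeasure P]
  {F : Filtration ℝ≥0 mΩ} {W : ℝ≥0 → Ω → ℝ}

theorem signatureRev_replicate (n : ℕ) :
    signatureRev F P W (List.replicate n 0)
      = fun (t : ℝ≥0) (_ : Ω) => (t : ℝ) ^ n / (n.factorial : ℝ) := by
  induction n with
  | zero => ext; simp [signatureRev]
  | succ n ih =>
    ext t ω
    rw [List.replicate_succ, signatureRev, if_pos rfl, ih]
    have h1 : ∫ s in (0 : ℝ)..t, (s.toNNReal : ℝ) ^ n / (n.factorial : ℝ)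
        = ∫ s in (0 : ℝ)..t, s ^ n / (n.factorial : ℝ) := by
      refine intervalIntegral.integral_congr fun s hs => ?_
      rw [Set.uIcc_of_le t.coe_nonneg] at hs
      simp only [Real.coe_toNNReal _ hs.1]
    simp only [h1]
    rw [intervalIntegral.integral_div, integral_pow, Nat.factorial_succ]
    push_cast
    field_simp
    simp

/-- The function `s ↦ sⁿ / n!`. -/
noncomputable def dividedPow (n : ℕ) (s : ℝ) : ℝ := s ^ n / (n.factorial : ℝ)

/-- The derivative of `s ↦ sⁿ / n!`. -/
noncomputable def dividedPowDeriv (n : ℕ) (s : ℝ) : ℝ := n * s ^ (n - 1) / (n.factorial : ℝ)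

theorem hasDerivAt_dividedPow (n : ℕ) (s : ℝ) :
    HasDerivAt (dividedPow n) (dividedPowDeriv n s) s := (hasDerivAt_pow n s).div_const _

theorem continuous_dividedPowDeriv (n : ℕ) : Continuous (dividedPowDeriv n) := by
  unfold dividedPowDeriv
  fun_prop

/-- The integral of `s ↦ sⁿ / n!` along the path `w`. -/
noncomputable def powIntegral (w : ℝ≥0 → ℝ) (t : ℝ≥0) (n : ℕ) : ℝ :=
  integralByParts (dividedPow n) (dividedPowDeriv n) w t

theorem signature_timeNoiseWord_ae_eq (hW : IsFBrownianMotion F P W) (t : ℝ≥0) (n : ℕ) :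
    ∀ᵐ ω ∂P, signature F P W t ω (timeNoiseWord n) = powIntegral (W · ω) t n := by
  have h := stratonovich_ae_eq hW (hasDerivAt_dividedPow n) (continuous_dividedPowDeriv n) t
  filter_upwards [h] with ω hω
  unfold signature timeNoiseWord
  rw [List.reverse_append, List.reverse_replicate, List.reverse_singleton, List.singleton_append,
    signatureRev, if_neg (by decide), signatureRev_replicate]
  exact hω

/-- Linearity is proved on the pathwise side, so Itô integrals on different grids never have to be
added. -/
theorem integralByParts_sum (a : ℕ → ℝ) (s : Finset ℕ) {w : ℝ≥0 → ℝ} (hw : Continuous w)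
    (t : ℝ≥0) : integralByParts (fun x => ∑ n ∈ s, a n * dividedPow n x)
      (fun x => ∑ n ∈ s, a n * dividedPowDeriv n x) w t = ∑ n ∈ s, a n * powIntegral w t n := by
  have h1 : ∫ x in (0 : ℝ)..t, (∑ n ∈ s, a n * dividedPowDeriv n x) * w x.toNNReal
      = ∑ n ∈ s, a n * ∫ x in (0 : ℝ)..t, dividedPowDeriv n x * w x.toNNReal := by
    simp_rw [Finset.sum_mul, mul_assoc]
    rw [intervalIntegral.integral_finsetSum fun n _ => ?_]
    · simp_rw [intervalIntegral.integral_const_mul]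
    · exact (((continuous_dividedPowDeriv n).mul
        (hw.comp continuous_real_toNNReal)).intervalIntegrable _ _).const_mul _
  unfold powIntegral integralByParts
  rw [h1, Finset.sum_mul, Finset.sum_mul, ← Finset.sum_sub_distrib, ← Finset.sum_sub_distrib]
  exact Finset.sum_congr rfl fun n _ => by ring

theorem isItoIntegral_sum_dividedPow (hW : IsFBrownianMotion F P W) (a : ℕ → ℝ) (s : Finset ℕ)
    (t : ℝ≥0) : IsItoIntegral F P W (fun x _ => ∑ n ∈ s, a n * dividedPow n x) t
      (fun ω => ∑ n ∈ s, a n * powIntegral (W · ω) t n) := by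
  have h := isItoIntegral_integralByParts hW (f := fun x => ∑ n ∈ s, a n * dividedPow n x)
    (f' := fun x => ∑ n ∈ s, a n * dividedPowDeriv n x)
    (fun x => HasDerivAt.fun_sum fun n _ => (hasDerivAt_dividedPow n x).const_mul (a n))
    (continuous_finsetSum _ fun n _ => continuous_const.mul (continuous_dividedPowDeriv n)) t
  refine h.congr ?_
  filter_upwards [hW.isBrownian.cont] with ω hω
  exact integralByParts_sum a s hω t

/-- The source of the weight in `weightedSeries`: `∫₀ᵗ s^(2n) ds = t^(2n+1)/(2n + 1)`. -/
theorem eLpNorm_two_dividedPow (a : ℝ) (n : ℕ) (t : ℝ≥0) :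
    eLpNorm (fun s => a * dividedPow n s) 2 (volume.restrict (Set.Ioc (0 : ℝ) t))
      = ENNReal.ofReal (|a| * (t : ℝ) ^ ((n : ℝ) + 1 / 2) /
          ((n.factorial : ℝ) * √(2 * n + 1))) := by
  have hc : Continuous fun s => a * dividedPow n s := by
    unfold dividedPow
    fun_prop
  have hm : MemLp (fun s => a * dividedPow n s) 2 (volume.restrict (Set.Ioc (0 : ℝ) t)) := by
    obtain ⟨C, -, hC⟩ := exists_abs_le_Icc hc t
    refine MemLp.of_bound hc.aestronglyMeasurable C ?_
    filter_upwards [ae_restrict_mem measurableSet_Ioc] with s hs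
    exact hC s ⟨hs.1.le, hs.2⟩
  rw [eLpNorm_two_eq_ofReal_sqrt hm]
  congr 1
  have h1 : ∫ s in Set.Ioc (0 : ℝ) t, (a * dividedPow n s) ^ 2
      = (|a| / n.factorial) ^ 2 * ((t : ℝ) ^ (2 * n + 1) / (2 * n + 1)) := by
    rw [← intervalIntegral.integral_of_le t.coe_nonneg]
    have : ∀ s : ℝ, (a * dividedPow n s) ^ 2 = (|a| / n.factorial) ^ 2 * s ^ (2 * n) := by
      intro s
      unfold dividedPow
      rw [div_pow, sq_abs, pow_mul', mul_pow, div_pow]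
      ring
    simp_rw [this]
    rw [intervalIntegral.integral_const_mul, integral_pow]
    simp
  have h2 : √((t : ℝ) ^ (2 * n + 1)) = (t : ℝ) ^ ((n : ℝ) + 1 / 2) := by
    rw [Real.sqrt_eq_rpow, ← Real.rpow_natCast, ← Real.rpow_mul t.coe_nonneg]
    congr 1
    push_cast
    ring
  rw [h1, Real.sqrt_mul (by positivity), Real.sqrt_sq (by positivity),
    Real.sqrt_div (by positivity), h2]
  field_simp

theorem eLpNorm_two_prod_dividedPow (a : ℝ) (n : ℕ) (t : ℝ≥0) :
    eLpNorm (fun p : ℝ × Ω => a * dividedPow n p.1) 2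
      ((volume.restrict (Set.Ioc (0 : ℝ) t)).prod P)
      = ENNReal.ofReal (|a| * (t : ℝ) ^ ((n : ℝ) + 1 / 2) /
          ((n.factorial : ℝ) * √(2 * n + 1))) := by
  have hmp : MeasurePreserving (Prod.fst : ℝ × Ω → ℝ)
      ((volume.restrict (Set.Ioc (0 : ℝ) t)).prod P) (volume.restrict (Set.Ioc (0 : ℝ) t)) :=
    measurePreserving_fst
  have hc : Continuous fun s => a * dividedPow n s := by
    unfold dividedPow
    fun_prop
  exact (eLpNorm_comp_measurePreserving (p := 2) hc.aestronglyMeasurable hmp).trans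
    (eLpNorm_two_dividedPow a n t)

/-- The series of integrals of the Taylor monomials of the kernel converges to the Volterra
integral. -/
theorem VolterraKernel.isItoIntegral_tsum (hW : IsFBrownianMotion F P W) {T : ℝ} {K : ℝ → ℝ}
    (hK : VolterraKernel T K) {t : ℝ≥0} (ht : (t : ℝ) ∈ Set.Ioc 0 T) :
    (∀ᵐ ω ∂P, Summable fun n => |kernelDeriv T K n t * (-1) ^ n * powIntegral (W · ω) t n|) ∧
    IsItoIntegral F P W (fun s _ => K (t - s)) t
      (fun ω => ∑' n, kernelDeriv T K n t * (-1) ^ n * powIntegral (W · ω) t n) := by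
  refine SigVolterra.isItoIntegral_tsum hW
    (G := fun n s _ => kernelDeriv T K n t * (-1) ^ n * dividedPow n s)
    (I := fun n ω => kernelDeriv T K n t * (-1) ^ n * powIntegral (W · ω) t n)
    (fun n => ?_) (fun N => ?_) ?_ ?_
  · simpa using isItoIntegral_sum_dividedPow hW (fun n => kernelDeriv T K n t * (-1) ^ n) {n} t
  · exact isItoIntegral_sum_dividedPow hW (fun n => kernelDeriv T K n t * (-1) ^ n) _ t
  · simp_rw [eLpNorm_two_prod_dividedPow]
    simpa [abs_mul, weightedSeries] using (hK.series_lt_top t ht).ne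
  -- The point `s = t` is discarded: there the kernel would be evaluated at its possible singularity
  -- `0`.
  · have h1 : ∀ᵐ s ∂(volume.restrict (Set.Ioc (0 : ℝ) t)), s ∈ Set.Ioo (0 : ℝ) t := by
      rw [← restrict_Ioo_eq_restrict_Ioc]
      exact ae_restrict_mem measurableSet_Ioo
    filter_upwards [Measure.quasiMeasurePreserving_fst.ae h1] with p hp
    exact hK.tendsto_taylor hp.1 hp.2 ht.2

theorem isItoIntegral_time_zero (H : ℝ → Ω → ℝ) :
    IsItoIntegral F P W H 0 (fun _ => (0 : ℝ)) := by
  have h0 : ((volume.restrict (Set.Ioc (0 : ℝ) (0 : ℝ≥0))).prod P) = 0 := by simp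
  refine ⟨by rw [h0]; exact aestronglyMeasurable_zero_measure _, aestronglyMeasurable_const,
    fun _ => Elementary.zero F, by simp, ?_⟩
  simp [Elementary.integral, Elementary.zero]

theorem VolterraKernel.admissible_and_isItoIntegral (hW : IsFBrownianMotion F P W) {T : ℝ}
    {K : ℝ → ℝ} (hK : VolterraKernel T K) (t : ℝ≥0) (htT : (t : ℝ) ≤ T) :
    (∀ᵐ ω ∂P, Admissible (volterraCoeff T K t) (signature F P W t ω)) ∧
    IsItoIntegral F P W (fun s _ => K (t - s)) t
      (fun ω => bracket (volterraCoeff T K t) (signature F P W t ω)) := by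
  rcases eq_or_ne t 0 with rfl | h0
  · have hc : volterraCoeff T K ((0 : ℝ≥0) : ℝ) = 0 := volterraCoeff_of_notMem K (by simp)
    have hl : ∀ (p : ExtTensor 2) n, level (0 : ExtTensor 2) p n = 0 := by simp [level]
    rw [hc]
    refine ⟨Eventually.of_forall fun ω => by simp [Admissible, hl], ?_⟩
    simpa [bracket, hl] using isItoIntegral_time_zero (F := F) (P := P) (W := W)
      (fun s _ => K ((0 : ℝ≥0) - s))
  · have ht : (t : ℝ) ∈ Set.Ioc 0 T := ⟨by positivity, htT⟩
    obtain ⟨h1, h2⟩ := hK.isItoIntegral_tsum hW ht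
    have hsig : ∀ᵐ ω ∂P, ∀ n, level (volterraCoeff T K t) (signature F P W t ω) (n + 1)
        = kernelDeriv T K n t * (-1) ^ n * powIntegral (W · ω) t n := by
      filter_upwards [ae_all_iff.2 (signature_timeNoiseWord_ae_eq hW t)] with ω hω n
      rw [level_succ_volterraCoeff K ht, hω]
    have hadm : ∀ᵐ ω ∂P, Admissible (volterraCoeff T K t) (signature F P W t ω) := by
      filter_upwards [h1, hsig] with ω a b
      -- The word with `n` time letters has length `n + 1`, hence the shift between Taylor index and
      -- level.
      refine (summable_nat_add_iff 1).1 (a.congr fun n => ?_)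
      rw [b]
    refine ⟨hadm, h2.congr ?_⟩
    filter_upwards [hadm, hsig] with ω a b
    unfold bracket
    rw [(Summable.of_abs a).tsum_eq_zero_add, level_zero_volterraCoeff K ht, zero_add]
    exact tsum_congr fun n => (b n).symm

end Representation

/-! ### The Riemann–Liouville kernel -/

section RiemannLiouville

theorem eLpNorm_two_sq {α : Type*} {mα : MeasurableSpace α} {μ : Measure α} (g : α → ℝ≥0∞) :
    eLpNorm g 2 μ ^ 2 = ∫⁻ x, g x ^ 2 ∂μ := by
  have h := eLpNorm_nnreal_pow_eq_lintegral (p := 2) (f := g) (μ := μ) two_ne_zero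
  simpa using h

/-- Minkowski's inequality for series in `L²`. -/
theorem lintegral_tsum_sq_le {α : Type*} {mα : MeasurableSpace α} {μ : Measure α}
    {g : ℕ → α → ℝ≥0∞} (hg : ∀ n, Measurable (g n)) :
    ∫⁻ x, (∑' n, g n x) ^ 2 ∂μ ≤ (∑' n, eLpNorm (g n) 2 μ) ^ 2 := by
  -- Monotone convergence reduces the claim to finite sums.
  have hlim : Tendsto (fun N => ∫⁻ x, (∑ n ∈ Finset.range N, g n x) ^ 2 ∂μ) atTop
      (𝓝 (∫⁻ x, (∑' n, g n x) ^ 2 ∂μ)) := by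
    refine lintegral_tendsto_of_tendsto_of_monotone (fun N => ?_)
      (Eventually.of_forall fun x => ?_) (Eventually.of_forall fun x => ?_)
    · exact ((Finset.measurable_fun_sum _ fun n _ => hg n).pow_const 2).aemeasurable
    · intro M N hMN
      exact pow_le_pow_left' (Finset.sum_le_sum_of_subset (Finset.range_mono hMN)) 2
    · exact ((ENNReal.continuous_pow 2).tendsto _).comp ENNReal.summable.hasSum.tendsto_sum_nat
  refine le_of_tendsto' hlim fun N => ?_
  have h1 := eLpNorm_two_sq (μ := μ) (∑ n ∈ Finset.range N, g n)
  simp only [Finset.sum_apply] at h1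
  rw [← h1]
  exact pow_le_pow_left' ((eLpNorm_sum_le (fun n _ => (hg n).aestronglyMeasurable)
    one_le_two).trans (ENNReal.sum_le_tsum _)) 2

/-- The summability of the weighted series at `t` implies the square-integrability of the Taylor
majorant on `(0, t]`. -/
theorem lintegral_taylorMajorant_sq_lt_top {T t : ℝ} {K : ℝ → ℝ} (ht : 0 ≤ t)
    (h : weightedSeries T K t < ∞) : ∫⁻ s in Set.Ioc 0 t, taylorMajorant T K t s ^ 2 < ∞ := by
  have hc : ∀ n, Continuous fun s => kernelDeriv T K n t * dividedPow n s := fun n => by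
    unfold dividedPow
    fun_prop
  have h1 := lintegral_tsum_sq_le (μ := volume.restrict (Set.Ioc 0 t))
    (g := fun n s => ‖kernelDeriv T K n t * dividedPow n s‖ₑ) fun n => (hc n).measurable.enorm
  have h2 : ∀ n : ℕ, eLpNorm (fun s => ‖kernelDeriv T K n t * dividedPow n s‖ₑ) 2
      (volume.restrict (Set.Ioc 0 t)) = ENNReal.ofReal
        (|kernelDeriv T K n t| * t ^ ((n : ℝ) + 1 / 2) / ((n.factorial : ℝ) * √(2 * n + 1))) :=
    fun n => by
      lift t to ℝ≥0 using ht
      rw [eLpNorm_enorm]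
      exact eLpNorm_two_dividedPow _ n t
  simp_rw [h2] at h1
  refine lt_of_le_of_lt (le_trans (le_of_eq ?_) h1) (ENNReal.pow_lt_top h)
  refine setLIntegral_congr_fun measurableSet_Ioc fun s hs => ?_
  unfold taylorMajorant
  congr 1
  refine tsum_congr fun n => ?_
  rw [← ofReal_norm, norm_mul, Real.norm_eq_abs, Real.norm_eq_abs, dividedPow,
    abs_of_nonneg (a := s ^ n / _) (by have := hs.1.le; positivity), mul_div_assoc]

/-- Combines `log q ≥ 1 - 1/q` at `q = m/(m + 1)` with `exp y ≥ 1 + y`. -/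
theorem one_sub_div_le_rpow {p m : ℝ} (hp : 0 ≤ p) (hm : 0 < m) :
    1 - p / m ≤ (m / (m + 1)) ^ p := by
  have hq : 0 < m / (m + 1) := by positivity
  rw [Real.rpow_def_of_pos hq]
  have h1 := Real.one_sub_inv_le_log_of_pos hq
  have h2 : 1 - (m / (m + 1))⁻¹ = -(1 / m) := by field_simp; ring
  rw [h2] at h1
  have h3 := Real.add_one_le_exp (Real.log (m / (m + 1)) * p)
  have h4 : -(1 / m) * p ≤ Real.log (m / (m + 1)) * p := mul_le_mul_of_nonneg_right h1 hp
  have h5 : p / m = 1 / m * p := by ring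
  rw [h5]
  linarith

/-- The decay of the binomial coefficients of a real number `α`. -/
theorem exists_abs_descPochhammer_le {α : ℝ} (h1 : -1 ≤ α) (h2 : α ≤ 1) :
    ∃ C : ℝ, 0 ≤ C ∧ ∀ n : ℕ, |(descPochhammer ℝ n).eval α| / n.factorial
      ≤ C * ((n : ℝ) + 1) ^ (-(α + 1)) := by
  set a : ℕ → ℝ := fun n => |(descPochhammer ℝ n).eval α| / n.factorial with ha
  have hp : 0 ≤ α + 1 := by linarith
  have ha0 : ∀ n, 0 ≤ a n := fun n => by positivity
  -- The ratio of consecutive terms is `|n - α|/(n + 1)`, which equals `1 - (α + 1)/(n + 1)` once `n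
  -- ≥ 1 ≥ α`. The index `0` is therefore treated separately and adds `a 0` to the constant.
  have hstep : ∀ n : ℕ, 1 ≤ n → a (n + 1) ≤ a n * ((n + 1 : ℝ) / (n + 1 + 1)) ^ (α + 1) := by
    intro n hn
    have hn' : (1 : ℝ) ≤ n := by exact_mod_cast hn
    have e : a (n + 1) = a n * (1 - (α + 1) / (n + 1)) := by
      simp only [ha]
      rw [descPochhammer_succ_eval, abs_mul, abs_sub_comm, abs_of_nonneg (a := (n : ℝ) - α)
        (by linarith), Nat.factorial_succ]
      push_cast
      field_simp
      ring
    rw [e]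
    exact mul_le_mul_of_nonneg_left (one_sub_div_le_rpow hp (by positivity)) (ha0 n)
  -- The product `a n * (n + 1)^(α + 1)` is nonincreasing from `n = 1` on.
  have hmono : ∀ n : ℕ, a (n + 1) * ((n : ℝ) + 2) ^ (α + 1) ≤ a 1 * 2 ^ (α + 1) := by
    intro n
    induction n with
    | zero => simp
    | succ n ih =>
      refine le_trans ?_ ih
      have hs := hstep (n + 1) (by omega)
      rw [Real.div_rpow (by positivity) (by positivity)] at hs
      have hpos : 0 < (((n + 1 : ℕ) : ℝ) + 1 + 1) ^ (α + 1) := by positivity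
      push_cast at hs hpos ⊢
      rw [mul_div_assoc', le_div_iff₀ hpos] at hs
      convert hs using 3 <;> ring
  refine ⟨a 0 + a 1 * 2 ^ (α + 1), by have := ha0 0; have := ha0 1; positivity, fun n => ?_⟩
  change a n ≤ _
  rw [Real.rpow_neg (by positivity), ← div_eq_mul_inv, le_div_iff₀ (by positivity)]
  have hpos : 0 ≤ a 1 * (2 : ℝ) ^ (α + 1) := by have := ha0 1; positivity
  cases n with
  | zero => simpa using hpos
  | succ n =>
    have := hmono n
    push_cast
    rw [add_assoc (n : ℝ), one_add_one_eq_two]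
    linarith [ha0 0]

/-- The power is smooth across `T`, so the one-sided derivatives there agree with the ordinary ones.
-/
theorem kernelDeriv_rlKernel {T H t : ℝ} (ht : t ∈ Set.Ioc 0 T) (n : ℕ) :
    kernelDeriv T (rlKernel H) n t = (descPochhammer ℝ n).eval (H - 1 / 2) *
      t ^ (H - 1 / 2 - n) / Real.Gamma (H + 1 / 2) := by
  have hsm : ContDiffAt ℝ n (fun x : ℝ => x ^ (H - 1 / 2)) t :=
    Real.contDiffAt_rpow_const_of_ne ht.1.ne'
  have e : rlKernel H = fun x : ℝ => (Real.Gamma (H + 1 / 2))⁻¹ * x ^ (H - 1 / 2) := by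
    ext x
    rw [rlKernel, div_eq_inv_mul]
  unfold kernelDeriv
  rw [e, iteratedDerivWithin_eq_iteratedDeriv (uniqueDiffOn_Ioc 0 T) (contDiffAt_const.mul hsm) ht,
    iteratedDeriv_const_mul_field, iteratedDeriv_eq_iterate, Real.iter_deriv_rpow_const]
  exact (div_eq_inv_mul _ _).symm

/-- By scaling, every term is `t^H` times a number independent of `t`. Hence one `S` serves all `t`
and `T`, which yields both pointwise finiteness and integrability. -/
theorem exists_weightedSeries_rlKernel_le {H : ℝ} (hH0 : 0 < H) (hH1 : H < 1) :
    ∃ S : ℝ≥0∞, S ≠ ∞ ∧ ∀ T : ℝ, ∀ t ∈ Set.Ioc 0 T,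
      weightedSeries T (rlKernel H) t ≤ ENNReal.ofReal (t ^ H) * S := by
  obtain ⟨C, hC0, hC⟩ := exists_abs_descPochhammer_le (α := H - 1 / 2) (by linarith) (by linarith)
  have hg : 0 < Real.Gamma (H + 1 / 2) := Real.Gamma_pos_of_pos (by linarith)
  have hsum : Summable fun n : ℕ => C / Real.Gamma (H + 1 / 2) * ((n : ℝ) + 1) ^ (-(1 + H)) := by
    have h := (summable_nat_add_iff 1).2 (Real.summable_nat_rpow (p := -(1 + H)).2 (by linarith))
    simpa using h.mul_left (C / Real.Gamma (H + 1 / 2))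
  refine ⟨_, hsum.tsum_ofReal_ne_top, fun T t ht => ?_⟩
  have ht0 := ht.1
  unfold weightedSeries
  rw [← ENNReal.tsum_mul_left]
  refine ENNReal.tsum_le_tsum fun n => ?_
  rw [← ENNReal.ofReal_mul (by positivity)]
  refine ENNReal.ofReal_le_ofReal ?_
  rw [kernelDeriv_rlKernel ht, abs_div, abs_mul, abs_of_pos hg,
    abs_of_pos (Real.rpow_pos_of_pos ht0 _)]
  have e1 : t ^ (H - 1 / 2 - n) * t ^ ((n : ℝ) + 1 / 2) = t ^ H := by
    rw [← Real.rpow_add ht0]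
    congr 1
    ring
  have e2 : ((n : ℝ) + 1) ^ (1 / 2 : ℝ) ≤ √(2 * n + 1) := by
    rw [Real.sqrt_eq_rpow]
    exact Real.rpow_le_rpow (by positivity) (by linarith [(Nat.cast_nonneg n : (0 : ℝ) ≤ n)])
      (by norm_num)
  have hs0 : 0 < √(2 * (n : ℝ) + 1) := Real.sqrt_pos.2 (by positivity)
  have hn0 : 0 < ((n : ℝ) + 1) ^ (1 / 2 : ℝ) := by positivity
  have e3 : ((n : ℝ) + 1) ^ (-(1 + H)) = ((n : ℝ) + 1) ^ (-(H - 1 / 2 + 1)) /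
      ((n : ℝ) + 1) ^ (1 / 2 : ℝ) := by
    rw [← Real.rpow_sub (by positivity)]
    congr 1
    ring
  set D := |(descPochhammer ℝ n).eval (H - 1 / 2)|
  set g := Real.Gamma (H + 1 / 2)
  calc D * t ^ (H - 1 / 2 - n) / g * t ^ ((n : ℝ) + 1 / 2) / (n.factorial * √(2 * n + 1))
      = (t ^ (H - 1 / 2 - n) * t ^ ((n : ℝ) + 1 / 2)) / g * ((D / n.factorial) / √(2 * n + 1)) := by
        field_simp
    _ = t ^ H / g * ((D / n.factorial) / √(2 * n + 1)) := by rw [e1]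
    _ ≤ t ^ H / g * ((C * ((n : ℝ) + 1) ^ (-(H - 1 / 2 + 1))) / ((n : ℝ) + 1) ^ (1 / 2 : ℝ)) := by
        have := hC n
        gcongr
    _ = t ^ H * (C / g * ((n : ℝ) + 1) ^ (-(1 + H))) := by
        rw [e3]
        field_simp

theorem volterraKernel_rlKernel {T H : ℝ} (hT : 0 < T) (hH0 : 0 < H) (hH1 : H < 1) :
    VolterraKernel T (rlKernel H) := by
  obtain ⟨S, hS, hle⟩ := exists_weightedSeries_rlKernel_le hH0 hH1
  have hfin : ∀ t ∈ Set.Ioc 0 T, weightedSeries T (rlKernel H) t < ∞ := fun t ht =>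
    (hle T t ht).trans_lt (ENNReal.mul_lt_top ENNReal.ofReal_lt_top hS.lt_top)
  have hmeas : Measurable (rlKernel H) := by
    unfold rlKernel
    fun_prop
  refine ⟨?_, ?_, hfin, fun t ht => lintegral_taylorMajorant_sq_lt_top ht.1.le (hfin t ht), ?_⟩
  · rw [memLp_two_iff_integrable_sq hmeas.aestronglyMeasurable]
    have h1 : IntegrableOn (fun x : ℝ => x ^ (2 * H - 1) / Real.Gamma (H + 1 / 2) ^ 2)
        (Set.Ioc 0 T) := by
      -- The square of the kernel has exponent `2H - 1 > -1`, since `H > 0`.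
      have := intervalIntegral.intervalIntegrable_rpow' (a := 0) (b := T) (r := 2 * H - 1)
        (by linarith)
      rw [intervalIntegrable_iff_integrableOn_Ioc_of_le hT.le] at this
      exact this.div_const _
    refine h1.congr_fun (fun x hx => ?_) measurableSet_Ioc
    simp only [rlKernel, div_pow]
    rw [← Real.rpow_mul_natCast hx.1.le]
    congr 2
    push_cast
    ring
  · intro x hx
    exact ((Real.contDiffAt_rpow_const_of_ne hx.1.ne').div_const _).contDiffWithinAt
  · have hb : ∫⁻ t in Set.Ioc 0 T, weightedSeries T (rlKernel H) t
        ≤ ∫⁻ _ in Set.Ioc 0 T, ENNReal.ofReal (T ^ H) * S := by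
      refine setLIntegral_mono' measurableSet_Ioc fun t ht => (hle T t ht).trans ?_
      exact mul_le_mul_left (ENNReal.ofReal_le_ofReal
        (Real.rpow_le_rpow ht.1.le ht.2 hH0.le)) _
    refine hb.trans_lt ?_
    rw [setLIntegral_const]
    exact ENNReal.mul_lt_top (ENNReal.mul_lt_top ENNReal.ofReal_lt_top hS.lt_top)
      measure_Ioc_lt_top

end RiemannLiouville
end SigVolterra

theorem theoremT {Ω : Type*} {mΩ : MeasurableSpace Ω} (P : Measure Ω) [IsProbabilityMeasure P]
    (F : Filtration ℝ≥0 mΩ) (W : ℝ≥0 → Ω → ℝ) (hW : SigVolterra.IsFBrownianMotion F P W) :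
    (∀ (T : ℝ) (K : ℝ → ℝ), 0 < T → SigVolterra.VolterraKernel T K →
      (∀ t : ℝ≥0, (t : ℝ) ≤ T → ∀ᵐ ω ∂P,
        SigVolterra.Admissible (SigVolterra.volterraCoeff T K t)
          (SigVolterra.signature F P W t ω)) ∧
      SigVolterra.IsVolterraProcess F P W T K (fun t ω =>
        SigVolterra.bracket (SigVolterra.volterraCoeff T K t)
          (SigVolterra.signature F P W t ω)) ∧
      ∀ X : ℝ≥0 → Ω → ℝ, SigVolterra.IsVolterraProcess F P W T K X →
        ∀ t : ℝ≥0, (t : ℝ) ≤ T → ∀ᵐ ω ∂P,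
          X t ω = SigVolterra.bracket (SigVolterra.volterraCoeff T K t)
            (SigVolterra.signature F P W t ω)) ∧
    (∀ (T H : ℝ), 0 < T → 0 < H → H < 1 →
      SigVolterra.VolterraKernel T (SigVolterra.rlKernel H)) := by
  refine ⟨fun T K _ hK => ?_, fun T H hT hH0 hH1 =>
    SigVolterra.volterraKernel_rlKernel hT hH0 hH1⟩
  have h := hK.admissible_and_isItoIntegral hW
  -- The bracket is itself an Itô integral of `K(t - ·)`; any other version agrees with it by
  -- uniqueness.
  exact ⟨fun t ht => (h t ht).1, fun t ht => (h t ht).2,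
    fun X hX t ht => (hX t ht).ae_eq hW (h t ht).2⟩
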